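/- Let $K$ be a field and $N\ge 0$. A Dyck path $D$ of semilength $N$ is a lattice path in $\mathbb{Z}^2$ from $(0,1)$ to $(N,1)$ with up-steps $(0,1)$ and down-steps $(1,-1)$ that never goes below the line $y=1$. Its area sequence is $[c_0,\dots,c_N]$, where $c_i$ is the largest $y$ such that $(i,y)$ lies on $D$. The linear Nakayama algebra $A_D$ corresponding to $D$ is the one with Kupisch series $[c_0,\dots,c_N]$, that is, the path algebra over $K$ of the quiver $0\to 1\to\cdots\to N$ modulo the ideal generated by the paths of length $c_i$ starting at $i$ (for all $i$ with $i+c_i\le N$); here paths are composed from left to right, so that $\dim_K e_iA_D=c_i$. The Dyck path $D$ is called shod if $A_D$ is shod, that is, if every indecomposable finite-dimensional right $A_D$-module has projective dimension at most $1$ or injective dimension at most $1$. A peak of $D$ is a point of $D$ that is reached by an up-step and left by a down-step; a valley is a point that is reached by a down-step and left by an up-step. If $D$ has exactly three peaks, let $Q_2$ be the middle one, let $M_1$ be the valley that follows $Q_2$ and $M_2$ the valley that precedes $Q_2$ when $D$ is traversed from $(0,1)$ to $(N,1)$, and let $d_j$ be the distance of $M_j$ and $Q_2$, i.e. the number of steps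 of $D$ between them ($j=1,2$). **Theorem.** A Dyck path $D$ is shod if and only if it has at most two peaks, or it has exactly three peaks and $d_1=1$ or $d_2=1$. -/

import Mathlib

open CategoryTheory

universe u

/-! ## Dyck paths as lattice paths

A Dyck path of semilength `N` is Mathlib's `DyckWord` with `semilength = N`.  It is drawn in the grid
as a path from `(0, 1)` to `(N, 1)`: the letter `U` is the up-step `(0, 1)`, the letter `D` is the
down-step `(1, -1)`.  It never goes below the line `y = 1`. -/

namespace DyckWord

/-- The grid point reached by the path after its first `k` steps.  (The subtraction never truncates,
because every prefix of a Dyck word has at least as many `U`s as `D`s.) -/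
def gridPoint (p : DyckWord) (k : ℕ) : ℕ × ℕ :=
  ((p.toList.take k).count DyckStep.D,
    1 + (p.toList.take k).count DyckStep.U - (p.toList.take k).count DyckStep.D)

/-- The area sequence: `p.areaSeq i` is the largest `y` such that `(i, y)` lies on the path.
It is meaningful for `0 ≤ i ≤ p.semilength`. -/
def areaSeq (p : DyckWord) (i : ℕ) : ℕ :=
  ((Finset.range (p.toList.length + 1)).filter (fun k => (p.gridPoint k).1 = i)).sup
    (fun k => (p.gridPoint k).2)

/-- The peaks of the path: an element `k` stands for the point `p.gridPoint k`, which is reached by an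
up-step and left by a down-step. -/
def peaks (p : DyckWord) : Finset ℕ :=
  (Finset.range p.toList.length).filter (fun k =>
    0 < k ∧ p.toList[k - 1]? = some DyckStep.U ∧ p.toList[k]? = some DyckStep.D)

/-- The valleys of the path: an element `k` stands for the point `p.gridPoint k`, which is reached by
a down-step and left by an up-step. -/
def valleys (p : DyckWord) : Finset ℕ :=
  (Finset.range p.toList.length).filter (fun k =>
    0 < k ∧ p.toList[k - 1]? = some DyckStep.D ∧ p.toList[k]? = some DyckStep.U)

/-- The path `p` has exactly three peaks, and `d₁`, `d₂` are the distances (numbers of steps along the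
path) between the middle peak `Q₂` and its two neighbouring valleys `M₁`, `M₂`.

In the drawing used for Auslander-Reiten quivers the point `(N, 1)` is on the left and `(0, 1)` on the
right.  So the peaks `Q₁, Q₂, Q₃`, numbered from left to right in the drawing, are passed in the order
`Q₃, M₂, Q₂, M₁, Q₁` when one follows the steps of the path. -/
def HasThreePeaksWithDistances (p : DyckWord) (d₁ d₂ : ℕ) : Prop :=
  ∃ Q₃ M₂ Q₂ M₁ Q₁ : ℕ,
    Q₃ < M₂ ∧ M₂ < Q₂ ∧ Q₂ < M₁ ∧ M₁ < Q₁ ∧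
    p.peaks = {Q₁, Q₂, Q₃} ∧ p.valleys = {M₁, M₂} ∧
    M₁ = Q₂ + d₁ ∧ Q₂ = M₂ + d₂

end DyckWord

/-! ## Linear Nakayama algebras

The linear quiver has vertices `0, …, N` and one arrow `i ⟶ i + 1` for `0 ≤ i < N`.  Paths are
composed from left to right. -/

namespace LinearNakayama

/-- The generators of the path algebra of the linear quiver with vertices `0, …, N`: the trivial paths
at the vertices and the arrows, where `arrow i` goes from `i` to `i + 1`. -/
inductive Gen (N : ℕ) : Type
  | vertex (i : Fin (N + 1)) : Gen N
  | arrow (i : Fin N) : Gen N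

section

variable (K : Type u) [Field K] {N : ℕ}

/-- The trivial path at the vertex `i`, in the free algebra. -/
def vertex (i : Fin (N + 1)) : FreeAlgebra K (Gen N) := FreeAlgebra.ι K (Gen.vertex i)

/-- The arrow `i ⟶ i + 1`, in the free algebra. -/
def arrow (i : Fin N) : FreeAlgebra K (Gen N) := FreeAlgebra.ι K (Gen.arrow i)

/-- The path of length `l` that starts at the vertex `i`, that is, the product of the trivial path at
`i` and of the arrows `i ⟶ i + 1 ⟶ ⋯ ⟶ i + l`, in the free algebra. -/
def path (i : Fin (N + 1)) (l : ℕ) (h : (i : ℕ) + l ≤ N) : FreeAlgebra K (Gen N) :=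
  vertex K i * (List.ofFn (fun t : Fin l => arrow K ⟨(i : ℕ) + (t : ℕ), by omega⟩)).prod

/-- The first five relations present the path algebra of the linear quiver; the last one sets to zero
the path of length `c i` starting at `i`, for every vertex `i` at which such a path exists. -/
inductive Rel (c : Fin (N + 1) → ℕ) : FreeAlgebra K (Gen N) → FreeAlgebra K (Gen N) → Prop
  | vertex_mul_self (i : Fin (N + 1)) : Rel c (vertex K i * vertex K i) (vertex K i)
  | vertex_mul_vertex (i j : Fin (N + 1)) (h : i ≠ j) : Rel c (vertex K i * vertex K j) 0
  | sum_vertex : Rel c (∑ i : Fin (N + 1), vertex K i) 1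
  | source_mul_arrow (i : Fin N) : Rel c (vertex K i.castSucc * arrow K i) (arrow K i)
  | arrow_mul_target (i : Fin N) : Rel c (arrow K i * vertex K i.succ) (arrow K i)
  | path_eq_zero (i : Fin (N + 1)) (h : (i : ℕ) + c i ≤ N) : Rel c (path K i (c i) h) 0

end

end LinearNakayama

/-- The linear Nakayama algebra over `K` with the `N + 1` simple modules `0, …, N` and Kupisch series
`[c 0, …, c N]`: the path algebra of the linear quiver modulo the ideal generated by the paths of
length `c i` starting at `i`.  If `c N = 1`, `c i ≥ 2` for `i < N` and `c i ≤ c (i + 1) + 1`, then the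
paths starting at `i` of length less than `c i` form a basis of the right module `e_i A`, so that
`dim (e_i A) = c i`. -/
abbrev LinearNakayamaAlgebra (K : Type u) [Field K] {N : ℕ} (c : Fin (N + 1) → ℕ) : Type u :=
  RingQuot (LinearNakayama.Rel K c)

/-- The linear Nakayama algebra that corresponds to the Dyck path `p` of semilength `N`: it has `N + 1`
simple modules, and its Kupisch series is the area sequence of `p`. -/
abbrev DyckWord.NakayamaAlgebra (p : DyckWord) (K : Type u) [Field K] : Type u :=
  LinearNakayamaAlgebra K (fun i : Fin (p.semilength + 1) => p.areaSeq i)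

/-! ## Algebras of small homological dimension -/

/-- A `K`-algebra `A` is shod if every indecomposable finite-dimensional right `A`-module has projective
dimension at most one or injective dimension at most one.  Right `A`-modules are modules over `Aᵐᵒᵖ`. -/
def IsShod (K : Type u) [Field K] (A : Type u) [Ring A] [Algebra K A] : Prop :=
  ∀ (M : Type u) [AddCommGroup M] [Module K M] [Module Aᵐᵒᵖ M] [IsScalarTower K Aᵐᵒᵖ M]
    [FiniteDimensional K M],
    Indecomposable (ModuleCat.of Aᵐᵒᵖ M) →
      HasProjectiveDimensionLE (ModuleCat.of Aᵐᵒᵖ M) 1 ∨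
        HasInjectiveDimensionLE (ModuleCat.of Aᵐᵒᵖ M) 1

/-- A Dyck path is shod (over the field `K`) if the corresponding linear Nakayama algebra is shod. -/
def DyckWord.IsShod (p : DyckWord) (K : Type u) [Field K] : Prop :=
  _root_.IsShod K (p.NakayamaAlgebra K)

/-!
# Shod Dyck paths

A right module over the linear Nakayama algebra `A` is a vector space graded by the vertices, with a
shift operator `α` (the sum of all arrows) of degree one such that `e i * α ^ c i = 0`
(`LinearNakayama.homMk`, `LinearNakayama.intervalAction`). The indecomposable modules are the
interval modules: if `i` is the smallest vertex in the support of `M` and `x ∈ M e_i` is nonzero,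
then the submodule `x A` is a direct summand of `M`, because a functional on `M` that is nonzero on
the socle of `x A` and concentrated in its degree defines a retraction
(`LinearNakayama.exists_retract_interval`).

Let `e i = i + c i - 1` be the last vertex that can be reached from `i` by a nonzero path. The
interval module on `i, …, j` is projective if and only if `j = e i`, and it is injective if and only
if `e k < j` for all `k < i`. The projective cover of the interval `i, …, j` has the interval
`j + 1, …, e i` as kernel, and its injective hull has an interval that ends in `i - 1` as cokernel.
So both dimensions are at most one or not according to inequalities between the values of `e`, and
`LinearNakayama.isShod_iff` states the shod property as a condition on `e`.

For a Dyck path and a column `i < N`, the number `e i` is the number of up-steps before the down-step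
in column `i` (`DyckWord.reach`). Peaks and valleys are the places where `e` jumps
(`DyckWord.mem_peaks_iff`, `DyckWord.mem_valleys_iff`). An interval whose projective and injective
dimensions both exceed one requires a jump before `i` and a jump after `i`, hence three peaks
(`DyckWord.not_few_peaks`). Conversely, if the second and third peaks are in columns `a` and `b`, and
`e` takes the values `u < v` in the first two blocks of columns, then with exactly three peaks the
two distances are `b - a` and `v - u`, and the interval from `a + 1` to `v - 1` is bad when both are at
least two. With more peaks there is always a bad interval (`DyckWord.exists_bad_interval`).
-/

namespace LinearNakayama

open MulOpposite

/-! ### Generators of the algebra -/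

section Generators

variable {K : Type u} [Field K] {N : ℕ}

theorem mul_pow_of_mul_eq {B : Type*} [Monoid B] {E : ℕ → B} {T : B}
    (hET : ∀ k, E k * T = T * E (k + 1)) (k l : ℕ) : E k * T ^ l = T ^ l * E (k + l) := by
  induction l with
  | zero => simp
  | succ l ih => rw [pow_succ, ← mul_assoc, ih, mul_assoc, hET, mul_assoc, Nat.add_assoc]

/-- If an algebra homomorphism sends the vertices to idempotents `E k` and the arrows to `E k * T`,
where `T` shifts the index of the idempotents by one, then paths are sent to `E i * T ^ l`. -/
theorem map_path {B : Type*} [Ring B] [Algebra K B] (F : FreeAlgebra K (Gen N) →ₐ[K] B)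
    {E : ℕ → B} {T : B} (hv : ∀ i : Fin (N + 1), F (vertex K i) = E i)
    (ha : ∀ i : Fin N, F (arrow K i) = E i * T) (hE : ∀ k, E k * E k = E k)
    (hET : ∀ k, E k * T = T * E (k + 1)) (i : Fin (N + 1)) (l : ℕ) (h : (i : ℕ) + l ≤ N) :
    F (path K i l h) = E i * T ^ l := by
  induction l with
  | zero => simp [path, hv]
  | succ l ih =>
    have ih := ih (by omega)
    have hs : path K i (l + 1) h =
        path K i l (by omega) * arrow K ⟨(i : ℕ) + l, by omega⟩ := by
      simp only [path, List.ofFn_succ_last, List.prod_append, List.prod_singleton, mul_assoc]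
      rfl
    rw [hs, map_mul, ih, ha, mul_pow_of_mul_eq hET, mul_assoc, ← mul_assoc (E _) (E _), hE,
      ← mul_assoc, ← mul_pow_of_mul_eq hET, mul_assoc, ← pow_succ]

variable (c : Fin (N + 1) → ℕ)

variable (K) in
/-- The class of the trivial path at `k` in the linear Nakayama algebra, extended by `0` to all
natural numbers `k`. -/
noncomputable def idemA (k : ℕ) : LinearNakayamaAlgebra K c :=
  if h : k < N + 1 then RingQuot.mkAlgHom K (Rel K c) (vertex K ⟨k, h⟩) else 0

variable (K) in
/-- The sum of all arrows in the linear Nakayama algebra. -/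
noncomputable def shiftA : LinearNakayamaAlgebra K c :=
  ∑ i : Fin N, RingQuot.mkAlgHom K (Rel K c) (arrow K i)

theorem mk_vertex (i : Fin (N + 1)) :
    RingQuot.mkAlgHom K (Rel K c) (vertex K i) = idemA K c i := by
  simp [idemA, i.2]

theorem idemA_mul_self (k : ℕ) : idemA K c k * idemA K c k = idemA K c k := by
  unfold idemA
  split_ifs with h
  · rw [← map_mul]
    exact RingQuot.mkAlgHom_rel K (Rel.vertex_mul_self _)
  · simp

theorem idemA_mul_of_ne {k l : ℕ} (hkl : k ≠ l) : idemA K c k * idemA K c l = 0 := by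
  unfold idemA
  split_ifs with h h'
  · rw [← map_mul, RingQuot.mkAlgHom_rel K (Rel.vertex_mul_vertex _ _ (by simpa using hkl)),
      map_zero]
  all_goals simp

theorem sum_idemA : ∑ k ∈ Finset.range (N + 1), idemA K c k = 1 := by
  rw [Finset.sum_range]
  simp_rw [← mk_vertex]
  rw [← map_sum, RingQuot.mkAlgHom_rel K Rel.sum_vertex, map_one]

theorem idemA_mul_arrow (i : Fin N) :
    idemA K c i * RingQuot.mkAlgHom K (Rel K c) (arrow K i)
      = RingQuot.mkAlgHom K (Rel K c) (arrow K i) := by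
  have := mk_vertex (K := K) c i.castSucc
  rw [Fin.val_castSucc] at this
  rw [← this, ← map_mul]
  exact RingQuot.mkAlgHom_rel K (Rel.source_mul_arrow i)

theorem arrow_mul_idemA (i : Fin N) :
    RingQuot.mkAlgHom K (Rel K c) (arrow K i) * idemA K c (i + 1)
      = RingQuot.mkAlgHom K (Rel K c) (arrow K i) := by
  have := mk_vertex (K := K) c i.succ
  rw [Fin.val_succ] at this
  rw [← this, ← map_mul]
  exact RingQuot.mkAlgHom_rel K (Rel.arrow_mul_target i)

theorem idemA_mul_shiftA (k : ℕ) :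
    idemA K c k * shiftA K c = shiftA K c * idemA K c (k + 1) := by
  rw [shiftA, Finset.mul_sum, Finset.sum_mul]
  refine Finset.sum_congr rfl fun i _ => ?_
  by_cases h : k = i
  · subst h
    rw [idemA_mul_arrow, arrow_mul_idemA]
  · rw [← idemA_mul_arrow, ← mul_assoc, idemA_mul_of_ne c h, zero_mul, idemA_mul_arrow,
      ← arrow_mul_idemA, mul_assoc, idemA_mul_of_ne c (by omega), mul_zero]

theorem shiftA_mul_idemA_zero : shiftA K c * idemA K c 0 = 0 := by
  rw [shiftA, Finset.sum_mul]
  refine Finset.sum_eq_zero fun i _ => ?_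
  rw [← arrow_mul_idemA, mul_assoc, idemA_mul_of_ne c (by omega), mul_zero]

theorem mk_arrow (i : Fin N) :
    RingQuot.mkAlgHom K (Rel K c) (arrow K i) = idemA K c i * shiftA K c := by
  rw [shiftA, Finset.mul_sum, Finset.sum_eq_single i]
  · rw [idemA_mul_arrow]
  · intro j _ hj
    rw [← idemA_mul_arrow, ← mul_assoc, idemA_mul_of_ne c (by omega), zero_mul]
  · simp

theorem idemA_eq_zero {k : ℕ} (hk : N < k) : idemA K c k = 0 := by
  rw [idemA, dif_neg (by omega)]

theorem idemA_mul_shiftA_pow (i : Fin (N + 1)) : idemA K c i * shiftA K c ^ c i = 0 := by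
  by_cases h : (i : ℕ) + c i ≤ N
  · rw [← map_path (RingQuot.mkAlgHom K (Rel K c)) (mk_vertex c) (mk_arrow c) (idemA_mul_self c)
      (idemA_mul_shiftA c) i (c i) h, RingQuot.mkAlgHom_rel K (Rel.path_eq_zero i h), map_zero]
  · rw [mul_pow_of_mul_eq (idemA_mul_shiftA c), idemA_eq_zero c (by omega), mul_zero]

/-- The algebra is generated by the idempotents and the sum of the arrows. -/
theorem generator_induction {P : LinearNakayamaAlgebra K c → Prop}
    (hc : ∀ r, P (algebraMap K _ r)) (hi : ∀ k, P (idemA K c k)) (hs : P (shiftA K c))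
    (hm : ∀ a b, P a → P b → P (a * b)) (ha : ∀ a b, P a → P b → P (a + b)) (a) : P a := by
  obtain ⟨a, rfl⟩ := RingQuot.mkAlgHom_surjective K (Rel K c) a
  induction a using FreeAlgebra.induction with
  | grade0 r => simpa using hc r
  | grade1 x =>
    cases x with
    | vertex i => exact mk_vertex (K := K) c i ▸ hi i
    | arrow i => exact mk_arrow (K := K) c i ▸ hm _ _ (hi i) hs
  | mul a b h₁ h₂ => rw [map_mul]; exact hm _ _ h₁ h₂
  | add a b h₁ h₂ => rw [map_add]; exact ha _ _ h₁ h₂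

end Generators

/-! ### Right modules as graded spaces with a shift operator -/

section Modules

variable {K : Type u} [Field K] {N : ℕ} (c : Fin (N + 1) → ℕ)

variable (K) in
/-- The opposite of the linear Nakayama algebra, whose left modules are the right modules of the
algebra. -/
abbrev OpAlgebra : Type u := (LinearNakayamaAlgebra K c)ᵐᵒᵖ

variable (K) in
/-- Right multiplication by the trivial path at `k`. -/
noncomputable def idem (k : ℕ) : OpAlgebra K c := op (idemA K c k)

variable (K) in
/-- Right multiplication by the sum of the arrows. -/
noncomputable def shift : OpAlgebra K c := op (shiftA K c)

theorem idem_mul_self (k : ℕ) : idem K c k * idem K c k = idem K c k := by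
  simp [idem, ← op_mul, idemA_mul_self]

theorem idem_mul_of_ne {k l : ℕ} (h : k ≠ l) : idem K c k * idem K c l = 0 := by
  simp [idem, ← op_mul, idemA_mul_of_ne c h.symm]

theorem sum_idem : ∑ k ∈ Finset.range (N + 1), idem K c k = 1 := by
  simp only [idem]
  rw [← Finset.op_sum, sum_idemA, op_one]

theorem shift_pow_mul_idem (k l : ℕ) :
    shift K c ^ l * idem K c k = idem K c (k + l) * shift K c ^ l := by
  simp only [idem, shift, ← op_mul, ← op_pow, mul_pow_of_mul_eq (idemA_mul_shiftA c)]

theorem idem_zero_mul_shift : idem K c 0 * shift K c = 0 := by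
  simp [idem, shift, ← op_mul, shiftA_mul_idemA_zero]

theorem idem_eq_zero {k : ℕ} (hk : N < k) : idem K c k = 0 := by
  simp [idem, idemA_eq_zero c hk]

theorem shift_pow_mul_idem_eq_zero (i : Fin (N + 1)) {l : ℕ} (hl : c i ≤ l) :
    shift K c ^ l * idem K c i = 0 := by
  obtain ⟨d, rfl⟩ := Nat.exists_eq_add_of_le' hl
  have : shift K c ^ c i * idem K c i = 0 := by
    simp only [idem, shift, ← op_mul, ← op_pow, idemA_mul_shiftA_pow, op_zero]
  rw [pow_add, mul_assoc, this, mul_zero]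

variable {c}
variable {X Y : Type*} [AddCommGroup X] [Module K X] [Module (OpAlgebra K c) X]
  [IsScalarTower K (OpAlgebra K c) X] [AddCommGroup Y] [Module K Y] [Module (OpAlgebra K c) Y]
  [IsScalarTower K (OpAlgebra K c) Y]

/-- A `K`-linear map that preserves the grading and commutes with the shift operator is a module
homomorphism. -/
def homMk (f : X →ₗ[K] Y) (hi : ∀ k x, f (idem K c k • x) = idem K c k • f x)
    (hs : ∀ x, f (shift K c • x) = shift K c • f x) : X →ₗ[OpAlgebra K c] Y where
  toFun := f
  map_add' := map_add f
  map_smul' := by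
    intro r
    obtain ⟨a, rfl⟩ := op_surjective r
    induction a using generator_induction with
    | hc r =>
      intro x
      have : op (algebraMap K (LinearNakayamaAlgebra K c) r) = algebraMap K (OpAlgebra K c) r := rfl
      rw [this, algebraMap_smul, RingHom.id_apply, algebraMap_smul, map_smul]
    | hi k => exact hi k
    | hs => exact hs
    | hm a b h₁ h₂ =>
      intro x
      simp only [RingHom.id_apply] at h₁ h₂ ⊢
      rw [op_mul, mul_smul, mul_smul, h₂, h₁]
    | ha a b h₁ h₂ =>
      intro x
      simp only [RingHom.id_apply] at h₁ h₂ ⊢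
      rw [MulOpposite.op_add, add_smul, add_smul, map_add, h₁, h₂]

theorem sum_idem_smul {X : Type*} [AddCommGroup X] [Module (OpAlgebra K c) X] (x : X) :
    ∑ k ∈ Finset.range (N + 1), idem K c k • x = x := by
  rw [← Finset.sum_smul, sum_idem, one_smul]

end Modules

/-! ### Interval modules -/

section Interval

variable {K : Type u} [Field K] {N : ℕ} {c : Fin (N + 1) → ℕ}

/-- The interval with the `l + 1` vertices `i, …, i + l` supports an indecomposable module of the
linear Nakayama algebra: none of the paths inside it vanish. -/
structure IsSupport (c : Fin (N + 1) → ℕ) (i l : ℕ) : Prop where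
  le : i + l ≤ N
  lt : ∀ k : Fin (N + 1), i ≤ k → i + l < k + c k

variable (K) in
/-- The interval module with top `i` and length `l + 1`. The `t`-th coordinate lives at the
vertex `i + t`. The support condition is an argument because the module structure depends on it. -/
def Interval {i l : ℕ} (_ : IsSupport c i l) : Type u := Fin (l + 1) → K

variable {i l : ℕ} (h : IsSupport c i l)

noncomputable instance : AddCommGroup (Interval K h) :=
  inferInstanceAs (AddCommGroup (Fin (l + 1) → K))
noncomputable instance : Module K (Interval K h) := inferInstanceAs (Module K (Fin (l + 1) → K))
instance : FiniteDimensional K (Interval K h) :=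
  inferInstanceAs (FiniteDimensional K (Fin (l + 1) → K))

/-- The coordinates of an element of an interval module. -/
def Interval.toFun (f : Interval K h) : Fin (l + 1) → K := f

instance : FunLike (Interval K h) (Fin (l + 1)) K where
  coe := Interval.toFun h
  coe_injective _ _ hfg := hfg

/-- The element of an interval module with given coordinates. -/
def Interval.mk (f : Fin (l + 1) → K) : Interval K h := f

@[simp] theorem Interval.mk_apply {K : Type u} {i l : ℕ} (h : IsSupport c i l)
    (f : Fin (l + 1) → K) (t) : Interval.mk h f t = f t := rfl

theorem Interval.ext {K : Type u} {i l : ℕ} {h : IsSupport c i l} {f g : Interval K h}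
    (hfg : ∀ t, f t = g t) : f = g :=
  DFunLike.ext _ _ hfg

theorem Interval.congr_apply {K : Type u} {i l : ℕ} {h : IsSupport c i l} {f g : Interval K h}
    (hfg : f = g) (t : Fin (l + 1)) : f t = g t := by rw [hfg]

@[simp] theorem Interval.add_apply (f g : Interval K h) (t) : (f + g) t = f t + g t := rfl

@[simp] theorem Interval.smul_apply (r : K) (f : Interval K h) (t) : (r • f) t = r * f t := rfl

@[simp] theorem Interval.zero_apply (t) : (0 : Interval K h) t = 0 := rfl

/-- A coordinate of an interval module, as a linear functional. -/
def Interval.coord (t : Fin (l + 1)) : Interval K h →ₗ[K] K where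
  toFun f := f t
  map_add' _ _ := rfl
  map_smul' _ _ := rfl

@[simp] theorem Interval.coord_apply (t) (f : Interval K h) : Interval.coord h t f = f t := rfl

variable (K) in
/-- The projection of the interval `i, …, i + l` to the vertex `k`. -/
def intervalIdem (i l k : ℕ) : Module.End K (Fin (l + 1) → K) where
  toFun f t := if i + t = k then f t else 0
  map_add' f g := by ext t; simp only [Pi.add_apply]; split_ifs <;> simp
  map_smul' r f := by ext t; simp

variable (K) in
/-- The shift operator of an interval module. -/
def intervalShift (l : ℕ) : Module.End K (Fin (l + 1) → K) where
  toFun f := Fin.cases 0 fun t => f t.castSucc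
  map_add' f g := by ext t; cases t using Fin.cases <;> simp
  map_smul' r f := by ext t; cases t using Fin.cases <;> simp

theorem intervalIdem_mul_self (i l k : ℕ) :
    intervalIdem K i l k * intervalIdem K i l k = intervalIdem K i l k := by
  refine LinearMap.ext fun f => funext fun t => ?_
  simp only [intervalIdem, Module.End.mul_apply, LinearMap.coe_mk, AddHom.coe_mk]
  grind

theorem intervalIdem_mul_of_ne (i l : ℕ) {k m : ℕ} (h : k ≠ m) :
    intervalIdem K i l k * intervalIdem K i l m = 0 := by
  refine LinearMap.ext fun f => funext fun t => ?_
  simp only [intervalIdem, Module.End.mul_apply, LinearMap.coe_mk, AddHom.coe_mk,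
    LinearMap.zero_apply, Pi.zero_apply]
  grind

theorem intervalShift_mul_intervalIdem (i l k : ℕ) :
    intervalShift K l * intervalIdem K i l k = intervalIdem K i l (k + 1) * intervalShift K l := by
  refine LinearMap.ext fun f => funext fun t => ?_
  cases t using Fin.cases with
  | zero => simp [intervalIdem, intervalShift]
  | succ t => simp [intervalIdem, intervalShift, ← add_assoc]

theorem intervalIdem_eq_zero {k : ℕ} (h : i + l < k) : intervalIdem K i l k = 0 := by
  refine LinearMap.ext fun f => funext fun t => ?_
  simp only [intervalIdem, LinearMap.coe_mk, AddHom.coe_mk, LinearMap.zero_apply, Pi.zero_apply]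
  rw [if_neg (by omega)]

theorem intervalIdem_eq_zero_of_lt {k : ℕ} (h : k < i) : intervalIdem K i l k = 0 := by
  refine LinearMap.ext fun f => funext fun t => ?_
  simp only [intervalIdem, LinearMap.coe_mk, AddHom.coe_mk, LinearMap.zero_apply, Pi.zero_apply]
  rw [if_neg (by omega)]

/-- The right action on an interval module, on the generators of the algebra. -/
noncomputable def intervalGen (i l : ℕ) : Gen N → (Module.End K (Fin (l + 1) → K))ᵐᵒᵖ
  | .vertex k => op (intervalIdem K i l k)
  | .arrow k => op (intervalIdem K i l k) * op (intervalShift K l)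

theorem lift_intervalGen_rel (h : IsSupport c i l) ⦃x y : FreeAlgebra K (Gen N)⦄ (hxy : Rel K c x y) :
    FreeAlgebra.lift K (intervalGen (K := K) i l) x =
      FreeAlgebra.lift K (intervalGen (K := K) i l) y := by
  have hv (k : Fin (N + 1)) : FreeAlgebra.lift K (intervalGen (K := K) (N := N) i l) (vertex K k)
      = op (intervalIdem K i l k) := by simp [vertex, intervalGen]
  have ha (k : Fin N) : FreeAlgebra.lift K (intervalGen (K := K) (N := N) i l) (arrow K k)
      = op (intervalIdem K i l k) * op (intervalShift K l) := by simp [arrow, intervalGen]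
  have hE (k : ℕ) : op (intervalIdem K i l k) * op (intervalIdem K i l k)
      = op (intervalIdem K i l k) := by rw [← op_mul, intervalIdem_mul_self]
  have hET (k : ℕ) : op (intervalIdem K i l k) * op (intervalShift K l)
      = op (intervalShift K l) * op (intervalIdem K i l (k + 1)) := by
    rw [← op_mul, ← op_mul, intervalShift_mul_intervalIdem]
  induction hxy with
  | vertex_mul_self k => rw [map_mul, hv, hE]
  | vertex_mul_vertex k m hkm =>
    rw [map_mul, hv, hv, ← op_mul, intervalIdem_mul_of_ne _ _ (by omega), op_zero, map_zero]
  | sum_vertex =>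
    simp only [map_sum, hv, map_one]
    rw [← Finset.op_sum, ← op_one]
    congr 1
    refine LinearMap.ext fun f => funext fun t => ?_
    have := h.le
    rw [LinearMap.sum_apply, Finset.sum_apply, Finset.sum_eq_single ⟨i + t, by omega⟩]
    · simp [intervalIdem]
    · intro b _ hb
      simp only [intervalIdem, LinearMap.coe_mk, AddHom.coe_mk]
      exact if_neg fun hh => hb (Fin.ext hh.symm)
    · simp
  | source_mul_arrow k => rw [map_mul, ha, hv, ← mul_assoc, Fin.val_castSucc, hE]
  | arrow_mul_target k => rw [map_mul, ha, hv, hET, mul_assoc, Fin.val_succ, hE]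
  | path_eq_zero k hk =>
    rw [map_path _ hv ha hE hET, map_zero]
    by_cases hik : i ≤ k
    · have := h.lt k hik
      rw [mul_pow_of_mul_eq hET, intervalIdem_eq_zero this, op_zero, mul_zero]
    · rw [intervalIdem_eq_zero_of_lt (by omega), op_zero, zero_mul]

/-- The action of the opposite of the linear Nakayama algebra on an interval module. -/
noncomputable def intervalAction : OpAlgebra K c →ₐ[K] Module.End K (Fin (l + 1) → K) :=
  AlgHom.opComm (RingQuot.liftAlgHom K
    ⟨FreeAlgebra.lift K (intervalGen i l), lift_intervalGen_rel h⟩)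

theorem intervalAction_idem (k : ℕ) : intervalAction h (idem K c k) = intervalIdem K i l k := by
  unfold idem idemA
  split_ifs with hk
  · simp [intervalAction, AlgHom.opComm, vertex, intervalGen]
  · have := h.le
    rw [intervalIdem_eq_zero (by omega), op_zero, map_zero]

theorem intervalAction_shift : intervalAction h (shift K c) = intervalShift K l := by
  have hs : ∑ k ∈ Finset.range (N + 1), idem K c k * shift K c = shift K c := by
    rw [← Finset.sum_mul, sum_idem, one_mul]
  have key : intervalAction h (shift K c)
      = ∑ k : Fin N, intervalShift K l * intervalIdem K i l k := by
    simp [intervalAction, AlgHom.opComm, shift, shiftA, arrow, intervalGen]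
  rw [key, ← Finset.mul_sum]
  refine LinearMap.ext fun f => funext fun t => ?_
  have := h.le
  cases t using Fin.cases with
  | zero => simp [intervalShift]
  | succ t =>
    simp only [intervalShift, Module.End.mul_apply, LinearMap.coe_mk, AddHom.coe_mk, Fin.cases_succ]
    rw [LinearMap.sum_apply, Finset.sum_apply, Finset.sum_eq_single ⟨i + t, by omega⟩]
    · simp [intervalIdem]
    · intro b _ hb
      simp only [intervalIdem, LinearMap.coe_mk, AddHom.coe_mk]
      exact if_neg fun hh => hb (Fin.ext hh.symm)
    · simp

noncomputable instance : Module (OpAlgebra K c) (Interval K h) :=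
  Module.compHom (Fin (l + 1) → K) (intervalAction h).toRingHom

theorem interval_smul_def (r : OpAlgebra K c) (f : Interval K h) :
    r • f = (show Interval K h from intervalAction h r f) := rfl

instance : IsScalarTower K (OpAlgebra K c) (Interval K h) where
  smul_assoc r a f := by
    rw [interval_smul_def, interval_smul_def, map_smul]; rfl

@[simp] theorem idem_smul_apply (k : ℕ) (f : Interval K h) (t : Fin (l + 1)) :
    (idem K c k • f) t = if i + t = k then f t else 0 := by
  rw [interval_smul_def, intervalAction_idem]; rfl

@[simp] theorem shift_smul_zero (f : Interval K h) : (shift K c • f) 0 = 0 := by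
  rw [interval_smul_def, intervalAction_shift]; rfl

@[simp] theorem shift_smul_succ (f : Interval K h) (t : Fin l) :
    (shift K c • f) t.succ = f t.castSucc := by
  rw [interval_smul_def, intervalAction_shift]; rfl

/-- The coordinates of an element are shifted by the powers of the shift operator. -/
theorem shift_pow_smul_apply (f : Interval K h) (m : ℕ) (t : Fin (l + 1)) :
    (shift K c ^ m • f) t = if m ≤ t then f ⟨t - m, by omega⟩ else 0 := by
  induction m generalizing t with
  | zero => simp
  | succ m ih =>
    rw [pow_succ', mul_smul]
    cases t using Fin.cases with
    | zero => simp
    | succ t => simp [ih]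

theorem shift_pow_smul_eq_zero {m : ℕ} (hm : l < m) (f : Interval K h) :
    shift K c ^ m • f = 0 := by
  refine Interval.ext fun t => ?_
  rw [shift_pow_smul_apply, if_neg (by omega), Interval.zero_apply]

end Interval

/-! ### Homomorphisms from and to interval modules -/

section Hom

variable {K : Type u} [Field K] {N : ℕ} {c : Fin (N + 1) → ℕ} {i l : ℕ}

variable (K) in
/-- The standard generator of an interval module. -/
def Interval.gen (h : IsSupport c i l) : Interval K h := Interval.mk h fun t => if t = 0 then 1 else 0

theorem idem_smul_gen (h : IsSupport c i l) :
    idem K c i • Interval.gen K h = Interval.gen K h := by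
  refine Interval.ext fun t => ?_
  simp only [idem_smul_apply, Interval.gen, Interval.mk_apply]
  by_cases ht : t = 0 <;> simp [ht]

/-- An element of an interval module is the sum of its coordinates along the shifts of the
generator. -/
theorem Interval.eq_sum (h : IsSupport c i l) (f : Interval K h) :
    f = ∑ t : Fin (l + 1), f t • shift K c ^ (t : ℕ) • Interval.gen K h := by
  refine Interval.ext fun s => ?_
  rw [← Interval.coord_apply h s (∑ t, _), map_sum, Finset.sum_eq_single s]
  · simp [shift_pow_smul_apply, Interval.gen]
  · intro t _ hts
    rw [Interval.coord_apply, Interval.smul_apply, shift_pow_smul_apply]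
    split_ifs with hle
    · rw [Interval.gen, Interval.mk_apply, if_neg, mul_zero]
      rw [Ne, Fin.ext_iff] at hts
      rw [Fin.ext_iff]
      simp only [Fin.val_zero]
      omega
    · rw [mul_zero]
  · simp

variable {X Y : Type*} [AddCommGroup X] [Module K X] [Module (OpAlgebra K c) X]
  [IsScalarTower K (OpAlgebra K c) X] [AddCommGroup Y] [Module K Y] [Module (OpAlgebra K c) Y]
  [IsScalarTower K (OpAlgebra K c) Y]

theorem smul_algebra_comm (r : OpAlgebra K c) (a : K) (x : X) : r • a • x = a • r • x := by
  rw [← algebraMap_smul (OpAlgebra K c) a x, ← algebraMap_smul (OpAlgebra K c) a (r • x),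
    ← mul_smul, ← mul_smul, Algebra.commutes]

/-- The homomorphism from an interval module that sends the generator to `x`. -/
noncomputable def homOfGen (h : IsSupport c i l) (x : X) (hx : idem K c i • x = x)
    (hx' : shift K c ^ (l + 1) • x = 0) : Interval K h →ₗ[OpAlgebra K c] X :=
  homMk (c := c)
    { toFun := fun f => ∑ t : Fin (l + 1), f t • shift K c ^ (t : ℕ) • x
      map_add' := fun f g => by
        simp only [Interval.add_apply, add_smul, Finset.sum_add_distrib]
      map_smul' := fun r f => by
        simp only [Interval.smul_apply, mul_smul, Finset.smul_sum, RingHom.id_apply] }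
    (fun k f => by
      simp only [LinearMap.coe_mk, AddHom.coe_mk, Finset.smul_sum]
      refine Finset.sum_congr rfl fun t _ => ?_
      rw [smul_algebra_comm, ← hx, ← mul_smul _ (idem K c i), shift_pow_mul_idem, mul_smul,
        ← mul_smul _ (idem K c (i + t)), idem_smul_apply]
      split_ifs with hk
      · rw [← hk, idem_mul_self]
      · rw [idem_mul_of_ne c (Ne.symm hk), zero_smul, zero_smul, smul_zero])
    (fun f => by
      simp only [LinearMap.coe_mk, AddHom.coe_mk, Finset.smul_sum]
      rw [Fin.sum_univ_succ, Fin.sum_univ_castSucc]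
      simp only [shift_smul_zero, shift_smul_succ, zero_smul, zero_add, Fin.val_last,
        smul_algebra_comm (shift K c)]
      simp only [← mul_smul (shift K c), ← pow_succ', hx', smul_zero, add_zero, Fin.val_succ,
        Fin.val_castSucc])

theorem homOfGen_apply (h : IsSupport c i l) (x : X) (hx) (hx') (f : Interval K h) :
    homOfGen h x hx hx' f = ∑ t : Fin (l + 1), f t • shift K c ^ (t : ℕ) • x := rfl

@[simp] theorem homOfGen_gen (h : IsSupport c i l) (x : X) (hx) (hx') :
    homOfGen h x hx hx' (Interval.gen K h) = x := by
  rw [homOfGen_apply, Fin.sum_univ_succ]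
  simp [Interval.gen, Fin.succ_ne_zero]

/-- Homomorphisms from an interval module are determined by the image of the generator. -/
theorem Interval.hom_ext {h : IsSupport c i l} {f g : Interval K h →ₗ[OpAlgebra K c] X}
    (hfg : f (Interval.gen K h) = g (Interval.gen K h)) : f = g := by
  ext x
  have key (f : Interval K h →ₗ[OpAlgebra K c] X) :
      f x = ∑ t : Fin (l + 1), x t • shift K c ^ (t : ℕ) • f (Interval.gen K h) := by
    conv_lhs => rw [Interval.eq_sum h x]
    rw [map_sum]
    refine Finset.sum_congr rfl fun t _ => ?_
    rw [← algebraMap_smul (OpAlgebra K c), map_smul, map_smul, algebraMap_smul]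
  rw [key, key, hfg]

/-- The homomorphism to an interval module whose last coordinate is the functional `γ`. -/
noncomputable def homOfFunctional (h : IsSupport c i l) (γ : X →ₗ[K] K)
    (hγ : ∀ x, γ (idem K c (i + l) • x) = γ x) (hγ' : ∀ x, γ (shift K c ^ (l + 1) • x) = 0) :
    X →ₗ[OpAlgebra K c] Interval K h :=
  homMk (c := c)
    { toFun := fun x => Interval.mk h fun t => γ (shift K c ^ (l - t : ℕ) • x)
      map_add' := fun x y => by
        refine Interval.ext fun t => ?_
        simp only [Interval.add_apply, Interval.mk_apply, smul_add, map_add]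
      map_smul' := fun r x => by
        refine Interval.ext fun t => ?_
        simp only [RingHom.id_apply, Interval.smul_apply, Interval.mk_apply, smul_algebra_comm,
          map_smul, smul_eq_mul] }
    (fun k x => by
      refine Interval.ext fun t => ?_
      simp only [LinearMap.coe_mk, AddHom.coe_mk, idem_smul_apply, Interval.mk_apply]
      rw [← hγ, ← mul_smul (shift K c ^ _), shift_pow_mul_idem, ← mul_smul, ← mul_assoc]
      split_ifs with hk
      · subst hk
        rw [show i + t + (l - t) = i + l by omega, idem_mul_self, mul_smul, hγ]
      · rw [idem_mul_of_ne c (by omega), zero_mul, zero_smul, map_zero])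
    (fun x => by
      refine Interval.ext fun t => ?_
      simp only [LinearMap.coe_mk, AddHom.coe_mk, Interval.mk_apply]
      rw [← mul_smul, ← pow_succ]
      cases t using Fin.cases with
      | zero => simpa using hγ' x
      | succ t =>
        rw [shift_smul_succ, Interval.mk_apply, Fin.val_castSucc, Fin.val_succ]
        congr 3
        omega)

theorem homOfFunctional_apply (h : IsSupport c i l) (γ : X →ₗ[K] K) (hγ) (hγ') (x : X)
    (t : Fin (l + 1)) :
    homOfFunctional h γ hγ hγ' x t = γ (shift K c ^ (l - t : ℕ) • x) := rfl

/-- Homomorphisms to an interval module are determined by the last coordinate. -/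
theorem Interval.hom_ext_last {X : Type*} [AddCommGroup X] [Module (OpAlgebra K c) X]
    {h : IsSupport c i l} {f g : X →ₗ[OpAlgebra K c] Interval K h}
    (hfg : ∀ x, f x (Fin.last l) = g x (Fin.last l)) : f = g := by
  ext x
  refine Interval.ext fun t => ?_
  have key (f : X →ₗ[OpAlgebra K c] Interval K h) :
      f x t = f (shift K c ^ (l - t : ℕ) • x) (Fin.last l) := by
    rw [map_smul, shift_pow_smul_apply, if_pos (by simp)]
    exact congrArg (f x) (Fin.ext (by simp only [Fin.val_last]; omega))
  rw [key, key, hfg]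

end Hom

/-! ### Projective and injective interval modules -/

section ProjInj

variable {K : Type u} [Field K] {N : ℕ} {c : Fin (N + 1) → ℕ} {i l : ℕ}

theorem projective_interval (h : IsSupport c i l)
    (hl : ∀ k : Fin (N + 1), (k : ℕ) = i → c k = l + 1) :
    Module.Projective (OpAlgebra K c) (Interval K h) := by
  refine Module.Projective.of_lifting_property ?_
  intro M M' _ _ _ _ f g hf
  let : Module K M := Module.compHom M (algebraMap K (OpAlgebra K c))
  have : IsScalarTower K (OpAlgebra K c) M := IsScalarTower.of_algebraMap_smul fun _ _ => rfl
  let : Module K M' := Module.compHom M' (algebraMap K (OpAlgebra K c))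
  have : IsScalarTower K (OpAlgebra K c) M' := IsScalarTower.of_algebraMap_smul fun _ _ => rfl
  obtain ⟨x, hx⟩ := hf (g (Interval.gen K h))
  have := h.le
  have hc := hl ⟨i, by omega⟩ rfl
  refine ⟨homOfGen h (idem K c i • x) ?_ ?_, Interval.hom_ext ?_⟩
  · rw [← mul_smul, idem_mul_self]
  · rw [← mul_smul, shift_pow_mul_idem_eq_zero c ⟨i, by omega⟩ hc.le, zero_smul]
  · rw [LinearMap.comp_apply, homOfGen_gen, map_smul, hx, ← map_smul, idem_smul_gen]

theorem idem_mul_shift_pow_eq_zero {m : ℕ} (h : ∀ k : Fin (N + 1), (k : ℕ) + m = i → c k ≤ m)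
    (hi : i ≤ N) : idem K c i * shift K c ^ m = 0 := by
  by_cases him : m ≤ i
  · obtain ⟨k, rfl⟩ := Nat.exists_eq_add_of_le' him
    rw [← shift_pow_mul_idem]
    exact shift_pow_mul_idem_eq_zero c ⟨k, by omega⟩ (h ⟨k, by omega⟩ rfl)
  · obtain ⟨d, rfl⟩ := Nat.exists_eq_add_of_lt (not_le.1 him)
    have : idem K c i * shift K c ^ i = shift K c ^ i * idem K c 0 := by
      rw [shift_pow_mul_idem, zero_add]
    rw [show i + d + 1 = i + (1 + d) by omega, pow_add, ← mul_assoc, this, pow_add, pow_one,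
      mul_assoc, ← mul_assoc (idem K c 0), idem_zero_mul_shift, zero_mul, mul_zero]

theorem injective_interval (h : IsSupport c i l)
    (hl : ∀ k : Fin (N + 1), (k : ℕ) + 1 = i → c k ≤ l + 1) :
    Module.Injective (OpAlgebra K c) (Interval K h) := by
  refine ⟨fun M M' _ _ _ _ f hf g => ?_⟩
  let : Module K M := Module.compHom M (algebraMap K (OpAlgebra K c))
  have : IsScalarTower K (OpAlgebra K c) M := IsScalarTower.of_algebraMap_smul fun _ _ => rfl
  let : Module K M' := Module.compHom M' (algebraMap K (OpAlgebra K c))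
  have : IsScalarTower K (OpAlgebra K c) M' := IsScalarTower.of_algebraMap_smul fun _ _ => rfl
  let act (r : OpAlgebra K c) : M' →ₗ[K] M' :=
    { toFun := fun x => r • x
      map_add' := smul_add r
      map_smul' := fun a x => smul_algebra_comm r a x }
  obtain ⟨p, hp⟩ := LinearMap.exists_leftInverse_of_injective (f.restrictScalars K)
    (LinearMap.ker_eq_bot.2 hf)
  let γ : M' →ₗ[K] K := Interval.coord h (Fin.last l) ∘ₗ g.restrictScalars K ∘ₗ p ∘ₗ act (idem K c (i + l))
  have hγ (x : M') : γ (idem K c (i + l) • x) = γ x := by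
    simp only [γ, act, LinearMap.comp_apply, LinearMap.coe_mk, AddHom.coe_mk]
    rw [← mul_smul, idem_mul_self]
  have hγ' (x : M') : γ (shift K c ^ (l + 1) • x) = 0 := by
    simp only [γ, act, LinearMap.comp_apply, LinearMap.coe_mk, AddHom.coe_mk]
    rw [← mul_smul, idem_mul_shift_pow_eq_zero (fun k hk => hl k (by omega)) h.le, zero_smul,
      map_zero, map_zero, map_zero]
  refine ⟨homOfFunctional h γ hγ hγ', LinearMap.congr_fun
    (f := (homOfFunctional h γ hγ hγ').comp f) (g := g) (Interval.hom_ext_last fun x => ?_)⟩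
  have hpx : p (f (idem K c (i + l) • x)) = idem K c (i + l) • x := LinearMap.congr_fun hp _
  simp only [LinearMap.comp_apply, homOfFunctional_apply, γ, act, LinearMap.coe_mk,
    AddHom.coe_mk, Fin.val_last, Nat.sub_self, pow_zero, one_smul]
  rw [← map_smul, hpx]
  simp

end ProjInj
/-! ### Short exact sequences of interval modules -/

section Exact

variable {K : Type u} [Field K] {N : ℕ} {c : Fin (N + 1) → ℕ} {i l L d m : ℕ}

/-- The projection of an interval module to the quotient with the same top. -/
noncomputable def Interval.proj (h : IsSupport c i L) (h' : IsSupport c i l) (hl : l ≤ L) :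
    Interval K h →ₗ[OpAlgebra K c] Interval K h' :=
  homMk (c := c)
    { toFun := fun f => Interval.mk h' fun t => f (Fin.castLE (by omega) t)
      map_add' := fun f g => Interval.ext fun t => by simp
      map_smul' := fun r f => Interval.ext fun t => by simp }
    (fun k f => Interval.ext fun t => by
      rw [idem_smul_apply]
      exact idem_smul_apply h k f (Fin.castLE (by omega) t))
    (fun f => Interval.ext fun t => by
      cases t using Fin.cases with
      | zero =>
        rw [shift_smul_zero]
        exact shift_smul_zero h f
      | succ t =>
        rw [shift_smul_succ]
        exact shift_smul_succ h f (Fin.castLE (by omega) t))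

@[simp] theorem Interval.proj_apply (h : IsSupport c i L) (h' : IsSupport c i l) (hl : l ≤ L)
    (f : Interval K h) (t : Fin (l + 1)) :
    Interval.proj h h' hl f t = f (Fin.castLE (by omega) t) := rfl

/-- The inclusion of the submodule of an interval module that is generated in degree `i + d`. -/
noncomputable def Interval.incl (h : IsSupport c (i + d) m) (h' : IsSupport c i L)
    (hl : d + m = L) : Interval K h →ₗ[OpAlgebra K c] Interval K h' :=
  homMk (c := c)
    { toFun := fun f => Interval.mk h' fun t =>
        if ht : d ≤ t then f ⟨t - d, by omega⟩ else 0
      map_add' := fun f g => Interval.ext fun t => by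
        simp only [Interval.mk_apply, Interval.add_apply]
        split_ifs <;> simp
      map_smul' := fun r f => Interval.ext fun t => by simp }
    (fun k f => Interval.ext fun t => by
      simp only [LinearMap.coe_mk, AddHom.coe_mk, Interval.mk_apply, idem_smul_apply]
      split_ifs <;> first | rfl | omega)
    (fun f => Interval.ext fun t => by
      simp only [LinearMap.coe_mk, AddHom.coe_mk, Interval.mk_apply]
      cases t using Fin.cases with
      | zero =>
        rw [shift_smul_zero]
        split_ifs with ht
        · have : (⟨((0 : Fin (L + 1)) : ℕ) - d, by omega⟩ : Fin (m + 1)) = 0 := Fin.ext (by simp)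
          rw [this, shift_smul_zero]
        · rfl
      | succ t =>
        rw [shift_smul_succ, Interval.mk_apply]
        simp only [Fin.val_succ, Fin.val_castSucc]
        split_ifs with h₁ h₂ h₂
        · have : (⟨t + 1 - d, by omega⟩ : Fin (m + 1)) = Fin.succ ⟨t - d, by omega⟩ :=
            Fin.ext (by simp; omega)
          rw [this, shift_smul_succ]
          rfl
        · have : (⟨t + 1 - d, by omega⟩ : Fin (m + 1)) = 0 := Fin.ext (by simp; omega)
          rw [this, shift_smul_zero]
        · omega
        · rfl)

theorem Interval.incl_apply (h : IsSupport c (i + d) m) (h' : IsSupport c i L)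
    (hl : d + m = L) (f : Interval K h) (t : Fin (L + 1)) :
    Interval.incl h h' hl f t = if ht : d ≤ t then f ⟨t - d, by omega⟩ else 0 := rfl

theorem Interval.proj_surjective (h : IsSupport c i L) (h' : IsSupport c i l) (hl : l ≤ L) :
    Function.Surjective (Interval.proj (K := K) h h' hl) := by
  intro f
  refine ⟨Interval.mk h fun t => if ht : (t : ℕ) < l + 1 then f ⟨t, ht⟩ else 0,
    Interval.ext fun t => ?_⟩
  simp [Nat.lt_succ_iff.1 t.2]

theorem Interval.incl_injective (h : IsSupport c (i + d) m) (h' : IsSupport c i L)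
    (hl : d + m = L) : Function.Injective (Interval.incl (K := K) h h' hl) := by
  intro f g hfg
  refine Interval.ext fun t => ?_
  have := Interval.congr_apply hfg ⟨d + t, by omega⟩
  simpa [Interval.incl_apply] using this

theorem Interval.exact_incl_proj (h₁ : IsSupport c (i + (l + 1)) m) (h₂ : IsSupport c i L)
    (h₃ : IsSupport c i l) (hl : l + 1 + m = L) :
    Function.Exact (Interval.incl (K := K) h₁ h₂ hl) (Interval.proj h₂ h₃ (show l ≤ L by omega)) := by
  intro f
  constructor
  · intro hf
    refine ⟨Interval.mk h₁ fun t => f ⟨l + 1 + t, by omega⟩, Interval.ext fun t => ?_⟩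
    rw [Interval.incl_apply]
    split_ifs with ht
    · rw [Interval.mk_apply]
      congr 1
      exact Fin.ext (Nat.add_sub_cancel' ht)
    · exact (Interval.congr_apply hf ⟨t, by omega⟩).symm
  · rintro ⟨g, rfl⟩
    refine Interval.ext fun t => ?_
    rw [Interval.proj_apply, Interval.incl_apply, dif_neg (by simp; omega), Interval.zero_apply]

theorem Interval.shortExact (h₁ : IsSupport c (i + (l + 1)) m) (h₂ : IsSupport c i L)
    (h₃ : IsSupport c i l) (hl : l + 1 + m = L) :
    (ModuleCat.shortComplexOfCompEqZero (Interval.incl (K := K) h₁ h₂ hl)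
      (Interval.proj h₂ h₃ (show l ≤ L by omega))
      (Interval.exact_incl_proj h₁ h₂ h₃ hl).linearMap_comp_eq_zero).ShortExact :=
  ModuleCat.shortComplex_shortExact _ (Interval.exact_incl_proj h₁ h₂ h₃ hl)
    (Interval.incl_injective h₁ h₂ hl) (Interval.proj_surjective h₂ h₃ (by omega))

theorem Interval.gen_ne_zero (h : IsSupport c i l) : Interval.gen K h ≠ 0 := by
  intro h0
  have := Interval.congr_apply h0 0
  simp [Interval.gen] at this

/-- An interval module that is a proper quotient of an interval module with the same top is not
projective. -/
theorem not_projective_interval (h : IsSupport c i L) (h' : IsSupport c i l) (hl : l < L) :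
    ¬ Module.Projective (OpAlgebra K c) (Interval K h') := by
  intro hP
  obtain ⟨s, hs⟩ := Module.projective_lifting_property (Interval.proj (K := K) h h' hl.le)
    LinearMap.id (Interval.proj_surjective h h' hl.le)
  -- The section sends the generator to `y`, whose leading coordinate is `1`, but `y` is killed by
  -- a power of the shift that does not kill the generator of the bigger module.
  set y := s (Interval.gen K h') with hy
  have h1 : y 0 = 1 := by
    have := Interval.congr_apply (LinearMap.congr_fun hs (Interval.gen K h')) 0
    simpa [hy, Interval.gen] using this
  have h2 : shift K c ^ (l + 1) • y = 0 := by
    rw [hy, ← map_smul, shift_pow_smul_eq_zero h' (Nat.lt_succ_self l), map_zero]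
  have h3 := Interval.congr_apply h2 ⟨l + 1, by omega⟩
  rw [shift_pow_smul_apply, if_pos le_rfl, Interval.zero_apply] at h3
  have h4 : (⟨l + 1 - (l + 1), by omega⟩ : Fin (L + 1)) = 0 := Fin.ext (by simp)
  simp only [h4] at h3
  exact one_ne_zero (h1.symm.trans h3)

/-- An interval module that can be extended at its top is not injective. -/
theorem not_injective_interval (h : IsSupport c (i + 1) l) (h' : IsSupport c i (1 + l)) :
    ¬ Module.Injective (OpAlgebra K c) (Interval K h) := by
  intro hI
  obtain ⟨r, hr⟩ := hI.out (Interval.incl (K := K) h h' rfl) (Interval.incl_injective h h' rfl)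
    LinearMap.id
  -- The retraction kills the generator for reasons of degree, hence also its shift.
  have h0 : r (Interval.gen K h') = 0 := by
    rw [← idem_smul_gen, map_smul]
    refine Interval.ext fun t => ?_
    rw [idem_smul_apply, if_neg (by omega), Interval.zero_apply]
  have h1 : Interval.incl h h' rfl (Interval.gen K h) = shift K c • Interval.gen K h' := by
    refine Interval.ext fun t => ?_
    rw [Interval.incl_apply]
    cases t using Fin.cases with
    | zero => simp
    | succ t =>
      rw [shift_smul_succ, dif_pos (by simp)]
      simp only [Interval.gen, Interval.mk_apply, Fin.ext_iff, Fin.val_succ, Fin.val_castSucc,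
        Nat.add_sub_cancel, Fin.val_zero]
  have h2 := hr (Interval.gen K h)
  rw [h1, map_smul, h0, smul_zero] at h2
  exact Interval.gen_ne_zero h h2.symm

end Exact

/-! ### Indecomposable modules -/

section Indecomposable

open Limits

theorem indecomposable_of_idempotents {C : Type*} [Category* C] [Abelian C] {X : C}
    (hX : ¬ IsZero X) (h : ∀ p : X ⟶ X, p ≫ p = p → p = 0 ∨ p = 𝟙 X) : Indecomposable X := by
  refine ⟨hX, fun Y Z e => ?_⟩
  have key := h (e.hom ≫ biprod.fst ≫ biprod.inl ≫ e.inv) (by simp)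
  rcases key with h0 | h1
  · left
    rw [IsZero.iff_id_eq_zero]
    have : biprod.inl ≫ e.inv ≫ (e.hom ≫ biprod.fst ≫ biprod.inl ≫ e.inv) ≫ e.hom ≫ biprod.fst
      = 𝟙 Y := by simp
    rw [← this, h0]
    simp
  · right
    rw [IsZero.iff_id_eq_zero]
    have : biprod.inr ≫ e.inv ≫ (e.hom ≫ biprod.fst ≫ biprod.inl ≫ e.inv) ≫ e.hom ≫ biprod.snd
      = 0 := by simp
    rw [h1] at this
    simpa using this

theorem nonempty_iso_of_indecomposable_of_retract {C : Type*} [Category* C] [Abelian C] {X Z : C}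
    (hX : Indecomposable X) (hZ : ¬ IsZero Z) (s : Z ⟶ X) (g : X ⟶ Z) (hs : s ≫ g = 𝟙 Z) :
    Nonempty (X ≅ Z) := by
  have : IsSplitEpi g := ⟨⟨s, hs⟩⟩
  have hex : (ShortComplex.mk (kernel.ι g) g (kernel.condition g)).Exact :=
    ShortComplex.exact_of_f_is_kernel _ (kernelIsKernel g)
  have e := (ShortComplex.Splitting.ofExactOfSection _ hex s hs inferInstance).isoBinaryBiproduct
  rcases hX.2 _ _ e with h | h
  · have : Mono g := Preadditive.mono_of_kernel_zero (h.eq_of_src _ _)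
    have : IsIso g := isIso_of_mono_of_epi g
    exact ⟨asIso g⟩
  · exact absurd h hZ

variable {K : Type u} [Field K] {N : ℕ} {c : Fin (N + 1) → ℕ} {i l : ℕ}

theorem not_isZero_interval (h : IsSupport c i l) :
    ¬ IsZero (ModuleCat.of (OpAlgebra K c) (Interval K h)) := by
  intro h0
  have := ModuleCat.subsingleton_of_isZero h0
  exact Interval.gen_ne_zero h (Subsingleton.elim (α := Interval K h) _ _)

theorem idempotent_interval {h : IsSupport c i l}
    {p : Interval K h →ₗ[OpAlgebra K c] Interval K h} (hp : p ∘ₗ p = p) :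
    p = 0 ∨ p = LinearMap.id := by
  -- The part of degree `i` is spanned by the generator, so `p` acts on it by a scalar `a`.
  set a : K := p (Interval.gen K h) 0 with ha
  have hpa : p (Interval.gen K h) = a • Interval.gen K h := by
    refine Interval.ext fun t => ?_
    conv_lhs => rw [← idem_smul_gen, map_smul, idem_smul_apply]
    rw [Interval.smul_apply, Interval.gen, Interval.mk_apply]
    by_cases ht : t = 0
    · subst ht; simp [ha, Interval.gen]
    · rw [if_neg ht, if_neg, mul_zero]
      intro h2
      exact ht (Fin.ext (by simpa using h2))
  have haa : a * a = a := by
    have h1 := LinearMap.congr_fun hp (Interval.gen K h)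
    rw [LinearMap.comp_apply, hpa, ← algebraMap_smul (OpAlgebra K c) a, map_smul, hpa,
      algebraMap_smul, algebraMap_smul] at h1
    simpa [Interval.gen] using Interval.congr_apply h1 0
  rcases eq_or_ne a 0 with h0 | h0
  · exact Or.inl (Interval.hom_ext (by rw [hpa, h0, zero_smul, LinearMap.zero_apply]))
  · have h1 : a = 1 := mul_left_cancel₀ h0 (by rw [haa, mul_one])
    exact Or.inr (Interval.hom_ext (by rw [hpa, h1, one_smul, LinearMap.id_apply]))

theorem indecomposable_interval (h : IsSupport c i l) :
    Indecomposable (ModuleCat.of (OpAlgebra K c) (Interval K h)) := by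
  refine indecomposable_of_idempotents (not_isZero_interval h) fun p hp => ?_
  exact (idempotent_interval (ModuleCat.hom_ext_iff.1 hp)).imp
    (fun h0 => ModuleCat.hom_ext h0) (fun h1 => ModuleCat.hom_ext h1)

/-- Over a field, every nonzero right module `M` has an interval module as a direct summand: let `i`
be the smallest vertex with `M e_i ≠ 0` and let `x ∈ M e_i` be nonzero. By the minimality of `i`, a
functional that does not vanish on the socle of `x A` gives a retraction onto `x A`. -/
theorem exists_retract_interval (hc : ∀ k m : Fin (N + 1), k ≤ m → (k : ℕ) + c k ≤ m + c m)
    {M : Type*} [AddCommGroup M] [Module K M] [Module (OpAlgebra K c) M]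
    [IsScalarTower K (OpAlgebra K c) M] [Nontrivial M] :
    ∃ (i l : ℕ) (h : IsSupport c i l) (s : Interval K h →ₗ[OpAlgebra K c] M)
      (g : M →ₗ[OpAlgebra K c] Interval K h), g ∘ₗ s = LinearMap.id := by
  classical
  have hex : ∃ i, ∃ x : M, idem K c i • x ≠ 0 := by
    obtain ⟨x, hx⟩ := exists_ne (0 : M)
    by_contra! hcon
    exact hx (by rw [← sum_idem_smul (K := K) (c := c) x, Finset.sum_eq_zero fun k _ => hcon k x])
  set i := Nat.find hex with hi
  obtain ⟨x₀, hx₀⟩ := Nat.find_spec hex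
  have hmin (k : ℕ) (hk : k < i) (x : M) : idem K c k • x = 0 := by
    by_contra hne
    exact Nat.find_min hex hk ⟨x, hne⟩
  obtain ⟨x, hx, hxi⟩ : ∃ x : M, x ≠ 0 ∧ idem K c i • x = x :=
    ⟨_, hx₀, by rw [← mul_smul, idem_mul_self]⟩
  have hiN : i ≤ N := by
    by_contra hlt
    exact hx (by rw [← hxi, idem_eq_zero c (by omega), zero_smul])
  have hshift (l : ℕ) : shift K c ^ l • x = idem K c (i + l) • shift K c ^ l • x := by
    rw [← mul_smul (idem K c _), ← shift_pow_mul_idem, mul_smul, hxi]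
  have hnil : ∃ l, shift K c ^ (l + 1) • x = 0 := by
    refine ⟨N, ?_⟩
    rw [hshift, idem_eq_zero c (by omega), zero_smul]
  set l := Nat.find hnil with hl
  have hl1 : shift K c ^ (l + 1) • x = 0 := Nat.find_spec hnil
  have hl0 : shift K c ^ l • x ≠ 0 := by
    rcases Nat.eq_zero_or_pos l with h0 | h0
    · rw [h0, pow_zero, one_smul]
      exact hx
    · have := Nat.find_min hnil (m := l - 1) (by omega)
      rwa [Nat.sub_add_cancel h0] at this
  have h : IsSupport c i l := by
    refine ⟨?_, fun k hk => ?_⟩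
    · by_contra hlt
      exact hl0 (by rw [hshift, idem_eq_zero c (by omega), zero_smul])
    · have h1 : l < c ⟨i, by omega⟩ := by
        by_contra hle
        have := shift_pow_mul_idem_eq_zero (K := K) c ⟨i, by omega⟩ (not_lt.1 hle)
        exact hl0 (by rw [← hxi, ← mul_smul, this, zero_smul])
      have := hc ⟨i, by omega⟩ k hk
      simp only at this
      omega
  obtain ⟨γ₀, hγ₀⟩ := Module.Projective.exists_dual_ne_zero K hl0
  let act : M →ₗ[K] M :=
    { toFun := fun x => idem K c (i + l) • x
      map_add' := smul_add _
      map_smul' := fun a x => smul_algebra_comm _ a x }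
  let γ : M →ₗ[K] K := (γ₀ (shift K c ^ l • x))⁻¹ • (γ₀ ∘ₗ act)
  have hγ (y : M) : γ (idem K c (i + l) • y) = γ y := by
    simp only [γ, act, LinearMap.smul_apply, LinearMap.comp_apply, LinearMap.coe_mk,
      AddHom.coe_mk]
    rw [← mul_smul (idem K c _), idem_mul_self]
  have hγ' (y : M) : γ (shift K c ^ (l + 1) • y) = 0 := by
    rw [← hγ, ← mul_smul]
    by_cases h0 : i = 0
    · rw [idem_mul_shift_pow_eq_zero (fun k hk => by omega) h.le, zero_smul, map_zero]
    · rw [show i + l = i - 1 + (l + 1) by omega, ← shift_pow_mul_idem, mul_smul,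
        hmin _ (by omega), smul_zero, map_zero]
  refine ⟨i, l, h, homOfGen h x hxi hl1, homOfFunctional h γ hγ hγ', Interval.hom_ext ?_⟩
  rw [LinearMap.comp_apply, homOfGen_gen, LinearMap.id_apply]
  refine Interval.ext fun t => ?_
  rw [homOfFunctional_apply, Interval.gen, Interval.mk_apply]
  split_ifs with ht
  · subst ht
    simp only [γ, act, LinearMap.smul_apply, LinearMap.comp_apply, LinearMap.coe_mk,
      AddHom.coe_mk, Fin.val_zero, Nat.sub_zero]
    rw [← hshift, smul_eq_mul, inv_mul_cancel₀ hγ₀]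
  · have : (t : ℕ) ≠ 0 := fun h0 => ht (Fin.ext h0)
    rw [hshift, ← hγ, ← mul_smul, idem_mul_of_ne c (by omega), zero_smul, map_zero]

/-- Every indecomposable right module is an interval module. -/
theorem exists_iso_interval (hc : ∀ k m : Fin (N + 1), k ≤ m → (k : ℕ) + c k ≤ m + c m)
    (M : Type u) [AddCommGroup M] [Module K M] [Module (OpAlgebra K c) M]
    [IsScalarTower K (OpAlgebra K c) M] (hM : Indecomposable (ModuleCat.of (OpAlgebra K c) M)) :
    ∃ (i l : ℕ) (h : IsSupport c i l),
      Nonempty (ModuleCat.of (OpAlgebra K c) M ≅ ModuleCat.of (OpAlgebra K c) (Interval K h)) := by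
  have : Nontrivial M := by
    by_contra hn
    rw [not_nontrivial_iff_subsingleton] at hn
    exact hM.1 (ModuleCat.isZero_of_subsingleton _)
  obtain ⟨i, l, h, s, g, hsg⟩ := exists_retract_interval (K := K) hc (M := M)
  exact ⟨i, l, h, nonempty_iso_of_indecomposable_of_retract hM (not_isZero_interval h)
    (ModuleCat.ofHom s) (ModuleCat.ofHom g) (ModuleCat.hom_ext hsg)⟩

end Indecomposable

/-! ### Homological dimensions of interval modules -/

section Dimension

/-- The function `e` sends every vertex to the last vertex that can be reached from it along a
nonzero path. -/
structure IsReach {N : ℕ} (c : Fin (N + 1) → ℕ) (e : ℕ → ℕ) : Prop where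
  add_eq : ∀ k : Fin (N + 1), (k : ℕ) + c k = e k + 1
  mono : Monotone e
  le : ∀ k ≤ N, e k ≤ N

variable {K : Type u} [Field K] {N : ℕ} {c : Fin (N + 1) → ℕ} {e : ℕ → ℕ} {i l : ℕ}

theorem IsReach.isSupport (he : IsReach c e) (hi : i ≤ N) (hl : i + l ≤ e i) :
    IsSupport c i l := by
  refine ⟨hl.trans (he.le i hi), fun k hk => ?_⟩
  have := he.add_eq k
  have := he.mono hk
  omega

theorem IsReach.le_of_isSupport (he : IsReach c e) (h : IsSupport c i l) : i + l ≤ e i := by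
  have h1 := h.le
  have h2 := h.lt ⟨i, by omega⟩ le_rfl
  have h3 := he.add_eq ⟨i, by omega⟩
  simp only at h2 h3
  omega

theorem projective_interval_iff (he : IsReach c e) (h : IsSupport c i l) :
    Module.Projective (OpAlgebra K c) (Interval K h) ↔ i + l = e i := by
  have h1 := h.le
  constructor
  · intro hP
    by_contra hne
    have h2 := he.le_of_isSupport h
    exact not_projective_interval (he.isSupport (l := e i - i) (by omega) (by omega)) h (by omega) hP
  · intro hl
    refine projective_interval h fun k hk => ?_
    have := he.add_eq k
    rw [hk] at this
    omega

theorem injective_interval_iff (he : IsReach c e) (h : IsSupport c i l) :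
    Module.Injective (OpAlgebra K c) (Interval K h) ↔ ∀ k < i, e k < i + l := by
  have h1 := h.le
  constructor
  · intro hI k hk
    by_contra hle
    obtain ⟨j, rfl⟩ := Nat.exists_eq_succ_of_ne_zero (Nat.ne_zero_of_lt hk)
    have := he.mono (Nat.lt_succ_iff.1 hk)
    exact not_injective_interval h (he.isSupport (by omega) (by omega)) hI
  · intro hl
    refine injective_interval h fun k hk => ?_
    have h2 := he.add_eq k
    have h3 := hl k (by omega)
    omega

theorem hasProjectiveDimensionLE_one_interval_iff (he : IsReach c e) (h : IsSupport c i l) :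
    HasProjectiveDimensionLE (ModuleCat.of (OpAlgebra K c) (Interval K h)) 1 ↔
      i + l = e i ∨ e (i + l + 1) = e i := by
  have h1 := h.le
  have h2 := he.le_of_isSupport h
  by_cases hl : i + l = e i
  · have := (IsProjective.iff_projective _).1 ((projective_interval_iff (K := K) he h).2 hl)
    exact iff_of_true (hasProjectiveDimensionLT_of_ge _ 1 2 (by omega)) (Or.inl hl)
  · have hN := he.le i (by omega)
    have hL : IsSupport c i (e i - i) := he.isSupport (by omega) (by omega)
    have hm : IsSupport c (i + (l + 1)) (e i - (i + l + 1)) :=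
      he.isSupport (by omega) (by have := he.mono (show i ≤ i + (l + 1) by omega); omega)
    have hse := Interval.shortExact (K := K) hm hL h (by omega)
    have hP := (IsProjective.iff_projective _).1 ((projective_interval_iff (K := K) he hL).2
      (by omega))
    refine (hse.hasProjectiveDimensionLT_X₃_iff 0 hP).trans ?_
    rw [zero_add, ← projective_iff_hasProjectiveDimensionLT_one]
    refine (IsProjective.iff_projective _).symm.trans ?_
    refine (projective_interval_iff (K := K) he hm).trans ?_
    rw [← add_assoc i l 1]
    omega

theorem hasInjectiveDimensionLE_one_interval_iff (he : IsReach c e) (h : IsSupport c i l) :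
    HasInjectiveDimensionLE (ModuleCat.of (OpAlgebra K c) (Interval K h)) 1 ↔
      (∀ k < i, e k < i + l) ∨ ∀ k, i ≤ e k + 1 → i + l ≤ e k := by
  have h1 := h.le
  by_cases hl : ∀ k < i, e k < i + l
  · have := (Module.injective_iff_injective_object _ _).1
      ((injective_interval_iff (K := K) he h).2 hl)
    exact iff_of_true (hasInjectiveDimensionLT_of_ge _ 1 2 (by omega)) (Or.inl hl)
  · rw [or_iff_right hl]
    -- The injective hull is the interval module with the same socle and the smallest possible top.
    have hex : ∃ s, i + l ≤ e s := by
      push Not at hl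
      exact ⟨hl.choose, hl.choose_spec.2⟩
    obtain ⟨s, hs, hmin⟩ : ∃ s, i + l ≤ e s ∧ ∀ k < s, e k < i + l :=
      ⟨Nat.find hex, Nat.find_spec hex, fun k hk => not_le.1 (Nat.find_min hex hk)⟩
    have hsi : s < i := by
      by_contra hle
      exact hl fun k hk => hmin k (by omega)
    obtain ⟨m, rfl⟩ : ∃ m, i = s + (m + 1) := ⟨i - s - 1, by omega⟩
    have hL : IsSupport c s (m + 1 + l) := he.isSupport (by omega) (by omega)
    have hm : IsSupport c s m := he.isSupport (by omega) (by omega)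
    have hse := Interval.shortExact (K := K) h hL hm rfl
    have hI := (Module.injective_iff_injective_object _ _).1
      ((injective_interval_iff (K := K) he hL).2 fun k hk => by have := hmin k hk; omega)
    refine (hse.hasInjectiveDimensionLT_X₃_iff 0 hI).symm.trans ?_
    rw [zero_add, ← injective_iff_hasInjectiveDimensionLT_one]
    refine (Module.injective_iff_injective_object _ _).symm.trans ?_
    refine (injective_interval_iff (K := K) he hm).trans ?_
    constructor
    · intro hk k hik
      by_cases hks : k < s
      · have := hk k hks
        omega
      · have := he.mono (not_lt.1 hks)
        omega
    · intro hk k hks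
      have := hmin k hks
      have := hk k
      omega

/-- A linear Nakayama algebra is shod if and only if every interval module has projective or
injective dimension at most one, which is a condition on the vertices. -/
theorem isShod_iff (he : IsReach c e) :
    IsShod K (LinearNakayamaAlgebra K c) ↔
      ∀ i j, i ≤ N → i ≤ j → j ≤ e i → (j = e i ∨ e (j + 1) = e i) ∨
        ((∀ k < i, e k < j) ∨ ∀ k, i ≤ e k + 1 → j ≤ e k) := by
  constructor
  · intro hs i j hi hij hj
    obtain ⟨l, rfl⟩ := Nat.exists_eq_add_of_le hij
    have h := he.isSupport hi hj
    exact (hs (Interval K h) (indecomposable_interval h)).imp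
      (hasProjectiveDimensionLE_one_interval_iff he h).1
      (hasInjectiveDimensionLE_one_interval_iff he h).1
  · intro hc M _ _ _ _ _ hM
    have hmono (k m : Fin (N + 1)) (hkm : k ≤ m) : (k : ℕ) + c k ≤ m + c m := by
      rw [he.add_eq, he.add_eq]
      exact Nat.succ_le_succ (he.mono hkm)
    obtain ⟨i, l, h, ⟨iso⟩⟩ := exists_iso_interval hmono M hM
    refine (hc i (i + l) (by have := h.le; omega) (by omega) (he.le_of_isSupport h)).imp
      (fun hp => ?_) (fun hi => ?_)
    · have := (hasProjectiveDimensionLE_one_interval_iff (K := K) he h).2 hp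
      exact hasProjectiveDimensionLT_of_iso iso.symm _
    · have := (hasInjectiveDimensionLE_one_interval_iff (K := K) he h).2 hi
      exact hasInjectiveDimensionLT_of_iso iso.symm _

end Dimension

end LinearNakayama

namespace DyckWord

/-! ### Dyck paths through their down-steps -/

section DownSteps

variable (p : DyckWord)

/-- The number of down-steps among the first `k` steps. -/
def numDown (k : ℕ) : ℕ := (p.toList.take k).count DyckStep.D

theorem count_U_add_count_D (w : List DyckStep) :
    w.count DyckStep.U + w.count DyckStep.D = w.length := by
  induction w with
  | nil => rfl
  | cons s w ih => cases s <;> simp <;> omega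

theorem count_U_take {k : ℕ} (hk : k ≤ 2 * p.semilength) :
    (p.toList.take k).count DyckStep.U = k - p.numDown k := by
  have := count_U_add_count_D (p.toList.take k)
  rw [List.length_take, ← p.two_mul_semilength_eq_length, min_eq_left hk] at this
  rw [numDown]
  omega

theorem two_mul_numDown_le {k : ℕ} (hk : k ≤ 2 * p.semilength) : 2 * p.numDown k ≤ k := by
  have h1 := p.count_D_le_count_U k
  have h2 := count_U_add_count_D (p.toList.take k)
  rw [List.length_take, ← p.two_mul_semilength_eq_length, min_eq_left hk] at h2
  rw [numDown]
  omega

theorem numDown_succ (k : ℕ) :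
    p.numDown (k + 1) = p.numDown k + if p.toList[k]? = some DyckStep.D then 1 else 0 := by
  rw [numDown, numDown, List.take_add_one, List.count_append]
  congr 1
  cases h : p.toList[k]? with
  | none => simp
  | some s => cases s <;> simp

theorem numDown_zero : p.numDown 0 = 0 := by simp [numDown]

theorem numDown_mono : Monotone p.numDown :=
  monotone_nat_of_le_succ fun k => by rw [numDown_succ]; omega

theorem numDown_two_mul_semilength : p.numDown (2 * p.semilength) = p.semilength := by
  rw [numDown, p.two_mul_semilength_eq_length, List.take_length, ← p.semilength_eq_count_D]

/-- The length of the longest initial segment with at most `i` down-steps. For `i < p.semilength`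
this is the position of the down-step number `i`, counted from zero. -/
def downPos (i : ℕ) : ℕ := Nat.findGreatest (fun k => p.numDown k ≤ i) (2 * p.semilength)

theorem downPos_le (i : ℕ) : p.downPos i ≤ 2 * p.semilength := Nat.findGreatest_le _

theorem numDown_downPos_le (i : ℕ) : p.numDown (p.downPos i) ≤ i :=
  Nat.findGreatest_spec (P := fun k => p.numDown k ≤ i) (Nat.zero_le _)
    (by rw [numDown_zero]; exact Nat.zero_le i)

theorem le_downPos {i k : ℕ} (hk : k ≤ 2 * p.semilength) (h : p.numDown k ≤ i) :
    k ≤ p.downPos i := Nat.le_findGreatest hk h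

theorem downPos_of_semilength_le {i : ℕ} (hi : p.semilength ≤ i) :
    p.downPos i = 2 * p.semilength :=
  le_antisymm (p.downPos_le i) (p.le_downPos le_rfl (by rwa [numDown_two_mul_semilength]))

theorem getElem?_downPos {i : ℕ} (hi : i < p.semilength) :
    p.downPos i < 2 * p.semilength ∧ p.numDown (p.downPos i) = i ∧
      p.toList[p.downPos i]? = some DyckStep.D := by
  have h1 := p.numDown_downPos_le i
  have hlt : p.downPos i < 2 * p.semilength := by
    refine lt_of_le_of_ne (p.downPos_le i) fun heq => ?_
    rw [heq, numDown_two_mul_semilength] at h1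
    omega
  have h2 : ¬ p.numDown (p.downPos i + 1) ≤ i := fun h => by
    have := p.le_downPos hlt h
    omega
  rw [numDown_succ] at h2
  split_ifs at h2 with h3
  · exact ⟨hlt, by omega, h3⟩
  · omega

theorem numDown_downPos {i : ℕ} (hi : i ≤ p.semilength) : p.numDown (p.downPos i) = i := by
  rcases hi.lt_or_eq with h | h
  · exact (p.getElem?_downPos h).2.1
  · rw [p.downPos_of_semilength_le h.ge, numDown_two_mul_semilength, h]

theorem eq_downPos_of_getElem? {k : ℕ} (hk : p.toList[k]? = some DyckStep.D) :
    p.numDown k < p.semilength ∧ k = p.downPos (p.numDown k) := by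
  have hlen : k < 2 * p.semilength := by
    rw [two_mul_semilength_eq_length]
    exact (List.getElem?_eq_some_iff.1 hk).1
  have hs : p.numDown (k + 1) = p.numDown k + 1 := by rw [numDown_succ, if_pos hk]
  refine ⟨?_, le_antisymm (p.le_downPos hlen.le le_rfl) ?_⟩
  · have := p.numDown_mono (show k + 1 ≤ 2 * p.semilength by omega)
    rw [numDown_two_mul_semilength] at this
    omega
  · by_contra hlt
    have h1 := p.numDown_mono (show k + 1 ≤ p.downPos (p.numDown k) by omega)
    have h2 := p.numDown_downPos_le (p.numDown k)
    omega

theorem downPos_lt_downPos_succ {i : ℕ} (hi : i < p.semilength) :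
    p.downPos i + 1 ≤ p.downPos (i + 1) := by
  obtain ⟨h1, h2, h3⟩ := p.getElem?_downPos hi
  refine p.le_downPos h1 ?_
  rw [numDown_succ, if_pos h3, h2]

/-- For `i < p.semilength`, the number of up-steps before the down-step number `i`, counted from
zero. This is the last vertex that the Nakayama algebra of the path reaches from `i`; beyond the
last vertex it is extended by the identity. -/
def reach (i : ℕ) : ℕ := max i (p.downPos i - i)

theorem add_reach {i : ℕ} (hi : i ≤ p.semilength) : i + p.reach i = p.downPos i := by
  have h1 := p.numDown_downPos hi
  have h2 := p.two_mul_numDown_le (p.downPos_le i)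
  rw [reach, max_eq_right (by omega)]
  omega

theorem reach_of_semilength_le {i : ℕ} (hi : p.semilength ≤ i) : p.reach i = i := by
  rw [reach, p.downPos_of_semilength_le hi, max_eq_left (by omega)]

theorem le_reach (i : ℕ) : i ≤ p.reach i := le_max_left _ _

theorem reach_mono : Monotone p.reach := by
  refine monotone_nat_of_le_succ fun i => ?_
  rcases lt_or_ge i p.semilength with h | h
  · have h1 := p.add_reach h.le
    have h2 := p.add_reach (i := i + 1) h
    have h3 := p.downPos_lt_downPos_succ h
    omega
  · rw [p.reach_of_semilength_le h, p.reach_of_semilength_le (by omega)]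
    omega

theorem reach_le {i : ℕ} (hi : i ≤ p.semilength) : p.reach i ≤ p.semilength :=
  (p.reach_mono hi).trans_eq (p.reach_of_semilength_le le_rfl)

theorem lt_reach {i : ℕ} (hi : i < p.semilength) : i < p.reach i := by
  have h1 := p.add_reach hi.le
  obtain ⟨h2, h3, h4⟩ := p.getElem?_downPos hi
  have h5 := p.two_mul_numDown_le (show p.downPos i + 1 ≤ 2 * p.semilength from h2)
  rw [numDown_succ, if_pos h4] at h5
  omega

theorem getElem?_eq_D_iff {k : ℕ} :
    p.toList[k]? = some DyckStep.D ↔ ∃ i < p.semilength, k = i + p.reach i := by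
  constructor
  · intro h
    obtain ⟨h1, h2⟩ := p.eq_downPos_of_getElem? h
    exact ⟨_, h1, by rwa [p.add_reach h1.le]⟩
  · rintro ⟨i, hi, rfl⟩
    rw [p.add_reach hi.le]
    exact (p.getElem?_downPos hi).2.2

theorem getElem?_eq_U_iff {k : ℕ} (hk : k < 2 * p.semilength) :
    p.toList[k]? = some DyckStep.U ↔ ∀ i < p.semilength, k ≠ i + p.reach i := by
  rw [two_mul_semilength_eq_length] at hk
  have h := p.getElem?_eq_D_iff (k := k)
  rw [List.getElem?_eq_getElem hk, Option.some_inj] at h ⊢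
  have h' : p.toList[k] = DyckStep.U ↔ ¬ p.toList[k] = DyckStep.D := by
    cases p.toList[k] <;> simp
  rw [h', h]
  push Not
  rfl

theorem areaSeq_add {i : ℕ} (hi : i ≤ p.semilength) : i + p.areaSeq i = p.reach i + 1 := by
  have h1 := p.add_reach hi
  have h2 : p.areaSeq i = 1 + p.downPos i - 2 * i := by
    have hy {k : ℕ} (hk : k ≤ 2 * p.semilength) (hki : p.numDown k = i) :
        (p.gridPoint k).2 = 1 + k - 2 * i := by
      have h3 := p.two_mul_numDown_le hk
      rw [gridPoint, p.count_U_take hk]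
      rw [numDown] at hki h3 ⊢
      simp only
      omega
    apply le_antisymm
    · refine Finset.sup_le fun k hk => ?_
      rw [Finset.mem_filter, Finset.mem_range, ← p.two_mul_semilength_eq_length] at hk
      rw [hy (by omega) hk.2]
      have := p.le_downPos (i := i) (show k ≤ 2 * p.semilength by omega) hk.2.le
      omega
    · rw [← hy (p.downPos_le i) (p.numDown_downPos hi)]
      refine Finset.le_sup (f := fun k => (p.gridPoint k).2) ?_
      rw [Finset.mem_filter, Finset.mem_range, ← p.two_mul_semilength_eq_length]
      exact ⟨Nat.lt_succ_of_le (p.downPos_le i), p.numDown_downPos hi⟩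
  have h3 := p.le_reach i
  omega

theorem isReach : LinearNakayama.IsReach
    (fun i : Fin (p.semilength + 1) => p.areaSeq i) p.reach where
  add_eq k := p.areaSeq_add (Nat.lt_succ_iff.1 k.2)
  mono := p.reach_mono
  le _ := p.reach_le

/-! ### Peaks and valleys -/

theorem mem_peaks_iff {k : ℕ} : k ∈ p.peaks ↔ ∃ i < p.semilength, k = i + p.reach i ∧
    (i = 0 ∨ ∃ j, i = j + 1 ∧ p.reach j < p.reach (j + 1)) := by
  rw [peaks, Finset.mem_filter, Finset.mem_range, ← p.two_mul_semilength_eq_length]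
  constructor
  · rintro ⟨hk, hk0, hU, hD⟩
    obtain ⟨i, hi, rfl⟩ := p.getElem?_eq_D_iff.1 hD
    refine ⟨i, hi, rfl, ?_⟩
    rcases i with _ | j
    · exact Or.inl rfl
    · refine Or.inr ⟨j, rfl, ?_⟩
      have h1 := (p.getElem?_eq_U_iff (by omega)).1 hU j (by omega)
      have h2 := p.reach_mono (Nat.le_succ j)
      rw [Nat.succ_eq_add_one] at h2
      omega
  · rintro ⟨i, hi, rfl, hij⟩
    have h1 := p.lt_reach hi
    have h2 := p.reach_le hi.le
    refine ⟨by omega, by omega, (p.getElem?_eq_U_iff (by omega)).2 fun m hm heq => ?_,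
      p.getElem?_eq_D_iff.2 ⟨i, hi, rfl⟩⟩
    have hmi : m < i := by
      by_contra hle
      have := p.reach_mono (not_lt.1 hle)
      omega
    rcases hij with rfl | ⟨j, rfl, hj⟩
    · omega
    · have := p.reach_mono (Nat.lt_succ_iff.1 hmi)
      omega

theorem mem_valleys_iff {k : ℕ} : k ∈ p.valleys ↔
    ∃ i, i < p.semilength ∧ k = i + p.reach i + 1 ∧ p.reach i < p.reach (i + 1) := by
  rw [valleys, Finset.mem_filter, Finset.mem_range, ← p.two_mul_semilength_eq_length]
  constructor
  · rintro ⟨hk, hk0, hD, hU⟩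
    obtain ⟨i, hi, hik⟩ := p.getElem?_eq_D_iff.1 hD
    refine ⟨i, hi, by omega, ?_⟩
    have h1 := p.reach_mono (Nat.le_succ i)
    rw [Nat.succ_eq_add_one] at h1
    by_cases hi' : i + 1 < p.semilength
    · have h2 := (p.getElem?_eq_U_iff hk).1 hU (i + 1) hi'
      omega
    · have h3 := p.lt_reach hi
      omega
  · rintro ⟨i, hi, rfl, hii⟩
    have h1 := p.reach_le (show i + 1 ≤ p.semilength by omega)
    refine ⟨by omega, by omega, p.getElem?_eq_D_iff.2 ⟨i, hi, by omega⟩,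
      (p.getElem?_eq_U_iff (by omega)).2 fun m hm heq => ?_⟩
    have him : i < m := by
      by_contra hle
      have := p.reach_mono (not_lt.1 hle)
      omega
    have := p.reach_mono (show i + 1 ≤ m from him)
    omega

end DownSteps

end DyckWord

/-! ### The combinatorial criterion -/

theorem Monotone.exists_jump {e : ℕ → ℕ} (he : Monotone e) {s t v : ℕ} (hs : e s < v)
    (ht : v ≤ e t) : ∃ a, s ≤ a ∧ a < t ∧ e a < v ∧ v ≤ e (a + 1) := by
  have hex : ∃ m, v ≤ e m := ⟨t, ht⟩
  have h1 : ¬ v ≤ e s := not_le.2 hs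
  have hsm : s < Nat.find hex := by
    by_contra hle
    exact h1 ((Nat.find_spec hex).trans (he (not_lt.1 hle)))
  have hmt : Nat.find hex ≤ t := Nat.find_min' hex ht
  refine ⟨Nat.find hex - 1, by omega, by omega,
    not_le.1 (Nat.find_min hex (by omega)), ?_⟩
  rw [Nat.sub_add_cancel (by omega)]
  exact Nat.find_spec hex

namespace DyckWord

variable (p : DyckWord)

theorem reach_zero_mem_peaks (hN : 0 < p.semilength) : p.reach 0 ∈ p.peaks :=
  p.mem_peaks_iff.2 ⟨0, hN, by omega, Or.inl rfl⟩

theorem succ_lt_of_jump {a : ℕ} (ha : a < p.semilength) (h : p.reach a < p.reach (a + 1)) :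
    a + 1 < p.semilength := by
  have h1 := p.lt_reach ha
  have h2 := p.reach_le (show a + 1 ≤ p.semilength from ha)
  omega

theorem peak_of_jump {a : ℕ} (ha : a < p.semilength) (h : p.reach a < p.reach (a + 1)) :
    a + 1 + p.reach (a + 1) ∈ p.peaks :=
  p.mem_peaks_iff.2 ⟨a + 1, p.succ_lt_of_jump ha h, rfl, Or.inr ⟨a, rfl, h⟩⟩

theorem valley_of_jump {a : ℕ} (ha : a < p.semilength) (h : p.reach a < p.reach (a + 1)) :
    a + p.reach a + 1 ∈ p.valleys :=
  p.mem_valleys_iff.2 ⟨a, ha, rfl, h⟩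

/-- If the interval from `i` to `j` has projective and injective dimension greater than one, then
there are at least three peaks, and if there are exactly three, then both distances are at
least two. -/
theorem not_few_peaks {i j : ℕ} (hi : i ≤ p.semilength) (hj : j < p.reach i)
    (hj' : p.reach i < p.reach (j + 1)) (hk : ∃ k < i, j ≤ p.reach k)
    (hk' : ∃ k, i ≤ p.reach k + 1 ∧ p.reach k < j) :
    ¬ (p.peaks.card ≤ 2 ∨
      ∃ d₁ d₂ : ℕ, p.HasThreePeaksWithDistances d₁ d₂ ∧ (d₁ = 1 ∨ d₂ = 1)) := by
  obtain ⟨k₁, hk₁, hjk₁⟩ := hk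
  obtain ⟨k₀, -, hk₀j⟩ := hk'
  have hiN := p.reach_le hi
  obtain ⟨a, -, hak, haj, hja⟩ := p.reach_mono.exists_jump hk₀j hjk₁
  obtain ⟨b, hib, hbj, hbi, hib'⟩ := p.reach_mono.exists_jump (Nat.lt_succ_self _) hj'
  have haJ : p.reach a < p.reach (a + 1) := by omega
  have hbJ : p.reach b < p.reach (b + 1) := by omega
  have haN : a < p.semilength := by omega
  have hbN : b < p.semilength := by omega
  have hP₀ := p.reach_zero_mem_peaks (by omega)
  have hPa := p.peak_of_jump haN haJ
  have hPb := p.peak_of_jump hbN hbJ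
  have hVa := p.valley_of_jump haN haJ
  have hVb := p.valley_of_jump hbN hbJ
  have h0a := p.reach_mono (Nat.zero_le (a + 1))
  have hai := p.reach_mono (show a + 1 ≤ i by omega)
  have hib'' := p.reach_mono hib
  rintro (hcard | ⟨d₁, d₂, ⟨Q₃, M₂, Q₂, M₁, Q₁, h1, h2, h3, h4, hp, hv, hd₁, hd₂⟩, hd⟩)
  · have hsub : ({p.reach 0, a + 1 + p.reach (a + 1), b + 1 + p.reach (b + 1)} : Finset ℕ) ⊆
        p.peaks := by
      intro x hx
      simp only [Finset.mem_insert, Finset.mem_singleton] at hx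
      rcases hx with rfl | rfl | rfl <;> assumption
    have := Finset.card_le_card hsub
    rw [Finset.card_eq_three.2 ⟨_, _, _, by omega, by omega, by omega, rfl⟩] at this
    omega
  · rw [hp] at hP₀ hPa hPb
    rw [hv] at hVa hVb
    simp only [Finset.mem_insert, Finset.mem_singleton] at hP₀ hPa hPb hVa hVb
    -- There is no jump between `a + 1` and `i`, since it would lead to a third valley.
    have hai' : p.reach (a + 1) = p.reach i := by
      by_contra hne
      obtain ⟨m, ham, hmi, hm, hm'⟩ := p.reach_mono.exists_jump
        (show p.reach (a + 1) < p.reach (a + 1) + 1 by omega)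
        (show p.reach (a + 1) + 1 ≤ p.reach i by omega)
      have hVm := p.valley_of_jump (a := m) (by omega) (by omega)
      have ham' := p.reach_mono ham
      have hmb := p.reach_mono (show m ≤ b by omega)
      rw [hv] at hVm
      simp only [Finset.mem_insert, Finset.mem_singleton] at hVm
      omega
    omega

theorem reach_eq_of_no_jump {s t : ℕ} (hst : s ≤ t)
    (h : ∀ a, s ≤ a → a < t → ¬ p.reach a < p.reach (a + 1)) : p.reach s = p.reach t := by
  by_contra hne
  have := p.reach_mono hst
  obtain ⟨a, h1, h2, h3, h4⟩ := p.reach_mono.exists_jump (show p.reach s < p.reach s + 1 by omega)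
    (show p.reach s + 1 ≤ p.reach t by omega)
  exact h a h1 h2 (by omega)

/-- The first jump of the function `reach` after a given column. -/
theorem exists_first_jump {s : ℕ}
    (h : ∃ a, s ≤ a ∧ a < p.semilength ∧ p.reach a < p.reach (a + 1)) :
    ∃ a, s ≤ a ∧ a < p.semilength ∧ p.reach a < p.reach (a + 1) ∧ p.reach s = p.reach a ∧
      ∀ m, s ≤ m → m < p.semilength → p.reach m < p.reach (m + 1) → a ≤ m := by
  obtain ⟨h1, h2, h3⟩ := Nat.find_spec h
  refine ⟨Nat.find h, h1, h2, h3, p.reach_eq_of_no_jump h1 fun m hm hm' hJ => ?_,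
    fun m hm hm' hJ => Nat.find_min' h ⟨hm, hm', hJ⟩⟩
  exact Nat.find_min h hm' ⟨hm, by omega, hJ⟩

/-- If there are at least four peaks, or three peaks with both distances at least two, then there is
an interval from `i` to `j` whose projective and injective dimension are greater than one. -/
theorem exists_bad_interval (hp : ¬ (p.peaks.card ≤ 2 ∨
      ∃ d₁ d₂ : ℕ, p.HasThreePeaksWithDistances d₁ d₂ ∧ (d₁ = 1 ∨ d₂ = 1))) :
    ∃ i j, i ≤ p.semilength ∧ i ≤ j ∧ j < p.reach i ∧ p.reach i < p.reach (j + 1) ∧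
      (∃ k < i, j ≤ p.reach k) ∧ ∃ k, i ≤ p.reach k + 1 ∧ p.reach k < j := by
  rw [not_or] at hp
  obtain ⟨hcard, hthree⟩ := hp
  -- The first two jumps exist since there are at least three peaks.
  have hexa : ∃ a, 0 ≤ a ∧ a < p.semilength ∧ p.reach a < p.reach (a + 1) := by
    by_contra hno
    push Not at hno
    have hsub : p.peaks ⊆ {p.reach 0} := by
      intro x hx
      obtain ⟨i, hi, rfl, rfl | ⟨m, rfl, hm⟩⟩ := p.mem_peaks_iff.1 hx
      · simp
      · have := hno m (Nat.zero_le m) (by omega)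
        omega
    have := (Finset.card_le_card hsub).trans_eq (Finset.card_singleton _)
    omega
  obtain ⟨a, -, haN, haJ, -, hamin⟩ := p.exists_first_jump hexa
  have hexb : ∃ b, a + 1 ≤ b ∧ b < p.semilength ∧ p.reach b < p.reach (b + 1) := by
    by_contra hno
    push Not at hno
    have hsub : p.peaks ⊆ {p.reach 0, a + 1 + p.reach (a + 1)} := by
      intro x hx
      obtain ⟨i, hi, rfl, rfl | ⟨m, rfl, hm⟩⟩ := p.mem_peaks_iff.1 hx
      · simp
      · have h1 := hamin m (Nat.zero_le m) (by omega) hm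
        rcases h1.eq_or_lt with rfl | h2
        · simp
        · have := hno m h2 (by omega)
          omega
    have := (Finset.card_le_card hsub).trans Finset.card_le_two
    omega
  obtain ⟨b, hab, hbN, hbJ, hrab, hbmin⟩ := p.exists_first_jump hexb
  have hbN' := p.reach_le (show b + 1 ≤ p.semilength from hbN)
  have haa := p.lt_reach haN
  have hbb := p.lt_reach hbN
  by_cases hexc : ∃ c, b + 1 ≤ c ∧ c < p.semilength ∧ p.reach c < p.reach (c + 1)
  · obtain ⟨c, hbc, hcN, hcJ, hrbc, -⟩ := p.exists_first_jump hexc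
    have hcc := p.lt_reach hcN
    by_cases h1 : p.reach a < b
    · -- The second peak and the valley before it leave room for the interval.
      refine ⟨p.reach a + 1, p.reach b - 1, by omega, by omega, ?_, ?_, ⟨p.reach a, by omega, ?_⟩,
        ⟨a, by omega, by omega⟩⟩
      · have := p.reach_mono (show a + 1 ≤ p.reach a + 1 by omega)
        omega
      · have h2 := p.reach_mono (show p.reach a + 1 ≤ b by omega)
        have h3 := p.lt_reach (show p.reach b < p.semilength by omega)
        rw [Nat.sub_add_cancel (by omega)]
        omega
      · have := p.reach_mono (show a + 1 ≤ p.reach a by omega)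
        omega
    by_cases h2 : p.reach b < c
    · -- The third peak and the valley after it leave room for the interval.
      have h3 := p.reach_mono (show b + 1 ≤ b + 2 by omega)
      have h4 := p.reach_mono (show b + 2 ≤ c by omega)
      exact ⟨b + 2, c, by omega, by omega, by omega, by omega, ⟨b + 1, by omega, by omega⟩,
        ⟨b, by omega, by omega⟩⟩
    · have h3 := p.reach_mono (show c + 1 ≤ p.reach b + 1 by omega)
      exact ⟨b + 1, p.reach b, by omega, by omega, by omega, by omega, ⟨b, by omega, le_rfl⟩,
        ⟨a, by omega, by omega⟩⟩
  · push Not at hexc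
    have h0a := p.reach_mono (Nat.zero_le a)
    have hd : p.HasThreePeaksWithDistances (b - a) (p.reach (a + 1) - p.reach a) := by
      refine ⟨p.reach 0, a + p.reach a + 1, a + 1 + p.reach (a + 1), b + p.reach b + 1,
        b + 1 + p.reach (b + 1), by omega, by omega, by omega, by omega, ?_, ?_, by omega, by omega⟩
      · ext x
        simp only [Finset.mem_insert, Finset.mem_singleton]
        constructor
        · intro hx
          obtain ⟨i, hi, rfl, rfl | ⟨m, rfl, hm⟩⟩ := p.mem_peaks_iff.1 hx
          · omega
          · have h1 := hamin m (Nat.zero_le m) (by omega) hm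
            rcases h1.eq_or_lt with rfl | h2
            · omega
            · have h3 := hbmin m h2 (by omega) hm
              rcases h3.eq_or_lt with rfl | h4
              · omega
              · have := hexc m h4 (by omega)
                omega
        · rintro (rfl | rfl | rfl)
          · exact p.peak_of_jump hbN hbJ
          · exact p.peak_of_jump haN haJ
          · exact p.reach_zero_mem_peaks (by omega)
      · ext x
        simp only [Finset.mem_insert, Finset.mem_singleton]
        constructor
        · intro hx
          obtain ⟨m, hm, rfl, hmJ⟩ := p.mem_valleys_iff.1 hx
          have h1 := hamin m (Nat.zero_le m) hm hmJ
          rcases h1.eq_or_lt with rfl | h2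
          · omega
          · have h3 := hbmin m h2 hm hmJ
            rcases h3.eq_or_lt with rfl | h4
            · omega
            · have := hexc m h4 hm
              omega
        · rintro (rfl | rfl)
          · exact p.valley_of_jump hbN hbJ
          · exact p.valley_of_jump haN haJ
    have hne : b - a ≠ 1 ∧ p.reach (a + 1) - p.reach a ≠ 1 :=
      ⟨fun h => hthree ⟨_, _, hd, Or.inl h⟩, fun h => hthree ⟨_, _, hd, Or.inr h⟩⟩
    have h2 := p.reach_mono (show a + 1 ≤ a + 2 by omega)
    have h3 := p.reach_mono (show a + 2 ≤ b by omega)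
    have h4 := p.reach_mono (show b + 1 ≤ p.reach b by omega)
    refine ⟨a + 2, p.reach b - 1, by omega, by omega, by omega, ?_, ⟨a + 1, by omega, by omega⟩,
      ⟨a, by omega, by omega⟩⟩
    rw [Nat.sub_add_cancel (by omega)]
    omega

end DyckWord

theorem theorem3p2 (K : Type u) [Field K] (p : DyckWord) :
    p.IsShod K ↔
      p.peaks.card ≤ 2 ∨
        ∃ d₁ d₂ : ℕ, p.HasThreePeaksWithDistances d₁ d₂ ∧ (d₁ = 1 ∨ d₂ = 1) := by
  refine (LinearNakayama.isShod_iff p.isReach).trans ⟨fun hs => ?_, fun hp i j hi hij hj => ?_⟩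
  · by_contra hp
    obtain ⟨i, j, hi, hij, hj, hj', ⟨k, hk, hjk⟩, ⟨k', hk', hkj'⟩⟩ := p.exists_bad_interval hp
    rcases hs i j hi hij hj.le with (h | h) | (h | h)
    · omega
    · omega
    · have := h k hk
      omega
    · have := h k' hk'
      omega
  · by_contra hbad
    push Not at hbad
    obtain ⟨⟨hj1, hj2⟩, hk, hk'⟩ := hbad
    have := p.reach_mono (show i ≤ j + 1 by omega)
    exact p.not_few_peaks hi (by omega) (by omega) hk hk' hp
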